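/- For $n\ge 1$, let $\mathrm{Tam}_n$ be the $n$-th Tamari lattice, realized as follows. Its elements are the Young diagrams (English notation; $(x,y)$ is the box in row $x\ge1$ and column $y\ge1$) contained in the staircase $\delta_{n-1}=(n-1,n-2,\dots,1)$. The silhouette of such a diagram $Y$, read from bottom left to top right, is a Dyck path (of length $2n$) of north and east steps, with one north step at the end of each (possibly empty) row. The prime path of a row is the part of this path that begins with the north step at the end of that row and ends when the path first returns to the line of slope one through the initial point of that step. If $B$ is the last box of its row, the $B$-strip is the set of all boxes of $Y$ whose right vertical edge lies on the prime path of the row of $B$. A corner box is a box that is the last of its row and the lowest of its column. The order on $\mathrm{Tam}_n$ is generated by declaring $Y<Y'$ whenever $Y'$ is obtained from $Y$ by removing the $B$-strip of a corner box $B$ of $Y$; the maximum is $\emptyset$ and the minimum is $\delta_{n-1}$. For an integer $i\ge -1$, let $\mathcal C_i(n)$ be the set of maximal chains $C=(\emptyset=Y_0>Y_1>\cdots>Y_{n+i}=\delta_{n-1})$ of length $n+i$ in $\mathrm{Tam}_n$. For $1\le r\le n+i$, label the boxes of $Y_r\setminus Y_{r-1}$ with $r$; this set of boxes is the $r$-set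 of $C$, and $C(x,y)$ denotes the label of $(x,y)\in\delta_{n-1}$. The chain $C$ has an $r^+$-full-set (the $r$-set is a plus-full-set) if the $r$-set contains a box of the first row, its box in the row of maximum index is a box $(k,n-k)$ of the outer diagonal, $k\in[n-1]$, and either $k=n-1$, or $k\le n-2$ and $C(k+1,n-k-1)<r$. Let $\mathcal N_i(n)$ be the set of all $C\in\mathcal C_i(n)$ that have no plus-full-sets. Let $i\ge-1$ and $n\ge1$. Then $\mathcal C_i(n)$ is finite, and for every $t$-element subset $U\subseteq[n+i]$ with $0\le t\le n-1$, $$\#\{C\in\mathcal C_i(n)\mid U=\{j\mid C\text{ has a }j^+\text{-full-set}\}\}=\#\mathcal N_i(n-t),$$ $$\#\{C\in\mathcal C_i(n)\mid U\subseteq\{j\mid C\text{ has a }j^+\text{-full-set}\}\}=\#\mathcal C_i(n-t).$$ Moreover $$\#\mathcal C_i(n)=\sum_{t=0}^{n-1}\binom{n+i}{t}\#\mathcal N_i(n-t)=\sum_{t=1}^{n}\binom{n+i}{t+i}\#\mathcal N_i(t),$$ $$\#\mathcal N_i(n)=\sum_{t=0}^{n-1}(-1)^t\binom{n+i}{t}\#\mathcal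 C_i(n-t)=\sum_{t=1}^{n}(-1)^{n-t}\binom{n+i}{t+i}\#\mathcal C_i(t).$$ -/

import Mathlib

/-! Rows and columns of Young diagrams are indexed from `0`, as in Mathlib: the box in row `x` and
column `y` (counted from one) is the cell `(x - 1, y - 1)`. -/

namespace Tamari

/-- Vertices of the `n`-th Tamari lattice: the Young diagrams contained in the staircase
`(n - 1, n - 2, …, 1)`, whose cells are the `(x, y)` with `x + y + 2 ≤ n`.
This is a structure and not a subtype, so that it does not inherit the order by containment. -/
@[ext]
structure Tam (n : ℕ) where
  diagram : YoungDiagram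
  contained : ∀ c ∈ diagram, c.1 + c.2 + 2 ≤ n

/-- The Dyck path of a Young diagram is its silhouette, a path of north and east steps that has one
north step for every row. The lattice point with `c` columns to its left and `b` rows above it is on
this path. (Above the first row, the path goes east.) -/
def OnPath (Y : YoungDiagram) (c b : ℕ) : Prop :=
  Y.rowLen b ≤ c ∧ (b = 0 ∨ c ≤ Y.rowLen (b - 1))

/-- The height of the prime path of row `d`, the prime Dyck subpath that begins with the north step
at the end of row `d`. This step begins at the point with `Y.rowLen d` columns to its left and
`d + 1` rows above it, and the prime Dyck subpath ends when the path first returns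
to the line of slope one through that point. -/
noncomputable def primeHeight (Y : YoungDiagram) (d : ℕ) : ℕ :=
  sInf {h | 1 ≤ h ∧ h ≤ d + 1 ∧ OnPath Y (Y.rowLen d + h) (d + 1 - h)}

/-- The `B`-strip, for `B` the last box of row `d`: all boxes whose right vertical edge is one of the
north steps of the prime path of row `d`, which are those of the rows
`d, d - 1, …, d - primeHeight Y d + 1`. -/
def strip (Y : YoungDiagram) (d : ℕ) : Set (ℕ × ℕ) :=
  {c | c ∈ Y ∧ (c.1, c.2 + 1) ∉ Y ∧ c.1 ≤ d ∧ d < c.1 + primeHeight Y d}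

/-- A corner box is the last box of its row and the lowest box of its column. -/
def IsCorner (Y : YoungDiagram) (c : ℕ × ℕ) : Prop :=
  c ∈ Y ∧ (c.1, c.2 + 1) ∉ Y ∧ (c.1 + 1, c.2) ∉ Y

/-- `Y'` is obtained from `Y` by removing the `B`-strip of a corner box `B` of `Y`. -/
def Step {n : ℕ} (Y Y' : Tam n) : Prop :=
  ∃ B : ℕ × ℕ, IsCorner Y.diagram B ∧
    (Y'.diagram.cells : Set (ℕ × ℕ)) = (Y.diagram.cells : Set (ℕ × ℕ)) \ strip Y.diagram B.1

theorem subset_of_reflTransGen {n : ℕ} {Y Y' : Tam n} (h : Relation.ReflTransGen Step Y Y') :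
    Y'.diagram ≤ Y.diagram := by
  induction h with
  | refl => exact le_rfl
  | tail _ hs ih =>
    obtain ⟨B, -, hB⟩ := hs
    refine le_trans ?_ ih
    intro c hc
    have : c ∈ ((_ : Tam n).diagram.cells : Set (ℕ × ℕ)) := Finset.mem_coe.2 hc
    rw [hB] at this
    exact Finset.mem_coe.1 this.1

/-- The Tamari order, generated by strip removals. -/
instance (n : ℕ) : PartialOrder (Tam n) where
  le Y Y' := Relation.ReflTransGen Step Y Y'
  le_refl _ := Relation.ReflTransGen.refl
  le_trans _ _ _ h h' := h.trans h'
  le_antisymm _ _ h h' :=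
    Tam.ext (le_antisymm (subset_of_reflTransGen h') (subset_of_reflTransGen h))

/-- A maximal chain `Y 0 > Y 1 > ⋯ > Y length` in the `n`-th Tamari lattice. -/
structure MaximalChain (n : ℕ) where
  length : ℕ
  Y : Fin (length + 1) → Tam n
  strictAnti : StrictAnti Y
  isMaxChain : IsMaxChain (· ≤ ·) (Set.range Y)

/-- The set `C_i(n)` of all maximal chains of length `n + i`. -/
def chains (i : ℤ) (n : ℕ) : Set (MaximalChain n) :=
  {C | (C.length : ℤ) = n + i}

namespace MaximalChain

variable {n : ℕ}

/-- The `r`-set of the tableau of the chain: the boxes labeled with `r`, which are those that are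
removed in the transition from `Y r` to `Y (r - 1)`, for `1 ≤ r ≤ length`. -/
def rSet (C : MaximalChain n) (r : ℕ) : Set (ℕ × ℕ) :=
  {c | ∃ k : Fin C.length, (k : ℕ) + 1 = r ∧
    c ∈ (C.Y k.succ).diagram ∧ c ∉ (C.Y k.castSucc).diagram}

/-- `e` is the end-box of a set of boxes: its box in the row of maximum index. -/
def IsEndBox (S : Set (ℕ × ℕ)) (e : ℕ × ℕ) : Prop :=
  e ∈ S ∧ ∀ c ∈ S, c.1 ≤ e.1

/-- The `r`-set is a full-set with end-box `e`: it begins in the first row and ends in the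
box `e` of the outer diagonal of the staircase. -/
def IsFullSetWithEnd (C : MaximalChain n) (r : ℕ) (e : ℕ × ℕ) : Prop :=
  (∃ c ∈ C.rSet r, c.1 = 0) ∧ IsEndBox (C.rSet r) e ∧ e.1 + e.2 + 2 = n

/-- The `r`-set is a plus-full-set: it is a full-set whose end-box `e` is in the last row of the
staircase, or has a southwest neighbor with a label less than `r`. -/
def HasPlusFullSet (C : MaximalChain n) (r : ℕ) : Prop :=
  ∃ e : ℕ × ℕ, C.IsFullSetWithEnd r e ∧
    (e.1 + 2 = n ∨ (e.1 + 3 ≤ n ∧ ∃ s < r, (e.1 + 1, e.2 - 1) ∈ C.rSet s))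

/-- The set of all `j` such that the `j`-set is a plus-full-set. -/
def plusFullSetLabels (C : MaximalChain n) : Set ℕ :=
  {j | C.HasPlusFullSet j}

end MaximalChain

/-- The set `N_i(n)` of all chains in `C_i(n)` that have no plus-full-sets. -/
def noFull (i : ℤ) (n : ℕ) : Set (MaximalChain n) :=
  {C | C ∈ chains i n ∧ ∀ j, ¬ C.HasPlusFullSet j}

end Tamari

/-! Write `f x` for the length of row `x` of a diagram. A strip removal with corner row `d` removes
one box from each of the rows `e, …, d`, where `e` is found by going up from row `d` until a row
`x` with `f d + d ≤ f x + x` is met (`step_iff`). Strip removals are exactly the covering relations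
(`covBy_iff_step`), so that the maximal chains of length `L` correspond to the sequences of row
lengths that are described by `IsRowChain n L`.

Call row `x` full when it has its maximal length `n - 1 - x`; the empty row `n - 1` is always full.
The plus-full-set with label `r` and end-box in row `k` exists exactly if row `k` becomes full at
time `r`, no earlier row is full at that time, and row `k + 1` is already full at time `r - 1`.

The heart of the proof is a bijection, for each `r`, from the chains of length `L` in the `n`-th
lattice onto the chains of length `L + 1` in the next one that have a plus-full-set with label `r`
(`insertPlus_image`, `insertPlus_injOn`). Given a chain, let `k` be the first row that is full at
time `r - 1`. The new chain has row `k` doubled at all times before `r`, and from time `r` on it has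
an additional box in each of the rows `0, …, k` (`insertSet`). Two facts make this work. If the
prime path of row `k` ends above the first row, then it did so at all earlier times
(`IsRowChain.below_of_le`), so before time `r` a strip that contains row `k` goes up to the first
row, in the old chain as well as in the new one. From time `r` on row `k` is full and lies in no
strip. Conversely, if the new chain has such a plus-full-set, then its rows `k` and `k + 1` agree
before time `r` (`IsRowChain.eq_succ_of_le`), so that one of them can be deleted.

The bijection keeps the labels less than `r` of plus-full-sets, adds the label `r`, and
increases the others by one. Removing the elements of `U` one by one, from the largest to the
smallest, gives the two counts for a given set `U` of labels (`ncard_plusLabels`). As there are at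
most `n - 1` plus-full-sets, the sums follow by double counting and inclusion-exclusion. -/

namespace Tamari

/-! ### Strip removals in terms of row lengths -/

/-- The effect of a strip removal on row lengths: `f'` is obtained from `f` by removing the last
boxes of the rows `e, …, d`, where row `d` ends in a corner box. In terms of `f x + x`, the
north step of row `x` begins strictly above the line of slope one through the initial point of the
north step of row `d` exactly when `f x + x < f d + d`; hence the prime path of row `d`
goes on until it meets a row `x` with `f d + d ≤ f x + x`. -/
structure IsStripRemoval (f f' : ℕ → ℕ) (e d : ℕ) : Prop where
  le : e ≤ d
  corner : f (d + 1) < f d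
  below : ∀ x, e ≤ x → x < d → f x + x < f d + d
  ret : ∀ x, x + 1 = e → f d + d ≤ f x + x
  rows : ∀ x, f x = f' x + if e ≤ x ∧ x ≤ d then 1 else 0

namespace IsStripRemoval

variable {f f' : ℕ → ℕ} {e d : ℕ}

theorem rows_mem (h : IsStripRemoval f f' e d) {x : ℕ} (h₁ : e ≤ x) (h₂ : x ≤ d) :
    f x = f' x + 1 := by
  have := h.rows x
  rwa [if_pos ⟨h₁, h₂⟩] at this

theorem rows_notMem (h : IsStripRemoval f f' e d) {x : ℕ} (hx : ¬ (e ≤ x ∧ x ≤ d)) :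
    f x = f' x := by
  have := h.rows x
  rwa [if_neg hx] at this

theorem anti_le (h : IsStripRemoval f f' e d) (x : ℕ) : f' x ≤ f x := by
  have := h.rows x
  omega

theorem below_le (h : IsStripRemoval f f' e d) {x : ℕ} (h₁ : e ≤ x) (h₂ : x ≤ d) :
    f x + x ≤ f d + d := by
  rcases h₂.lt_or_eq with h₂ | rfl
  · exact (h.below x h₁ h₂).le
  · exact le_rfl

/-- If row `k` belongs to the strip and its prime path ends above the first row, then the strip
begins in the first row. -/
theorem eq_zero (h : IsStripRemoval f f' e d) {k : ℕ} (h₁ : e ≤ k) (h₂ : k ≤ d)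
    (hk : ∀ x < k, f x + x < f k + k) : e = 0 := by
  by_contra he
  have h₃ := h.ret (e - 1) (by omega)
  have h₄ := hk (e - 1) (by omega)
  have h₅ := h.below_le h₁ h₂
  omega

theorem antitone_right (h : IsStripRemoval f f' e d) (hf : Antitone f) : Antitone f' := by
  refine antitone_nat_of_succ_le fun x => ?_
  have h₁ := h.rows x
  have h₂ := h.rows (x + 1)
  have h₃ := hf (Nat.le_add_right x 1)
  have h₄ := h.corner
  rcases eq_or_ne x d with rfl | hx
  · have := h.le
    split_ifs at h₁ h₂ <;> omega
  · have := h.le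
    split_ifs at h₁ h₂ <;> omega

theorem antitone_left (h : IsStripRemoval f f' e d) (hf : Antitone f') : Antitone f := by
  refine antitone_nat_of_succ_le fun x => ?_
  have h₁ := h.rows x
  have h₂ := h.rows (x + 1)
  have h₃ := hf (Nat.le_add_right x 1)
  have h₄ := h.corner
  have hle := h.le
  rcases eq_or_ne x d with rfl | hx
  · exact h₄.le
  · rcases eq_or_ne (x + 1) e with rfl | hx'
    · have h₅ := h.ret x rfl
      have h₆ := h.below_le le_rfl hle
      omega
    · split_ifs at h₁ h₂ <;> omega

/-- A strip removal is determined by its corner row. -/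
theorem top_unique (h : IsStripRemoval f f' e d) {f'' : ℕ → ℕ} {e' : ℕ}
    (h' : IsStripRemoval f f'' e' d) : e = e' := by
  by_contra hne
  rcases Nat.lt_or_gt_of_ne hne with hlt | hlt
  · have h₁ := h'.ret (e' - 1) (by omega)
    have h₂ := h.below (e' - 1) (by omega) (by have := h'.le; omega)
    omega
  · have h₁ := h.ret (e - 1) (by omega)
    have h₂ := h'.below (e - 1) (by omega) (by have := h.le; omega)
    omega

end IsStripRemoval

/-! ### Maximal chains in terms of row lengths -/

/-- A maximal chain of length `L` in the `n`-th Tamari lattice, in terms of row lengths: `g s x` is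
the length of row `x` of the `s`-th diagram. To make `g` unique, it is constant from time `L` on. -/
structure IsRowChain (n L : ℕ) (g : ℕ → ℕ → ℕ) : Prop where
  zero : ∀ x, g 0 x = 0
  step : ∀ s < L, ∃ e d, IsStripRemoval (g (s + 1)) (g s) e d
  last : ∀ s, L ≤ s → ∀ x, g s x = n - 1 - x

/-- Row chain version of `MaximalChain.plusFullSetLabels`. Row `k` is full at time `s` if
`g s k + k + 1 = n`. The strip that fills row `k` reaches the first row if and only if no earlier row
is full, and the end-box of that strip has a smaller southwest neighbor if and only if row `k + 1` is
already full. The (empty) row `n - 1` is full at all times, so that `k + 2 = n` needs no special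
treatment. For `j = 0` the conditions contradict each other. -/
def plusLabels (n : ℕ) (g : ℕ → ℕ → ℕ) : Set ℕ :=
  {j | ∃ k, k + 2 ≤ n ∧ (∀ x < k, g j x + x + 1 < n) ∧ g j k + k + 1 = n ∧
    g (j - 1) k + k + 1 < n ∧ g (j - 1) (k + 1) + k + 2 = n}

namespace IsRowChain

variable {n L : ℕ} {g : ℕ → ℕ → ℕ}

theorem le_succ (h : IsRowChain n L g) (s x : ℕ) : g s x ≤ g (s + 1) x := by
  rcases lt_or_ge s L with hs | hs
  · obtain ⟨e, d, hm⟩ := h.step s hs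
    exact hm.anti_le x
  · rw [h.last s hs, h.last (s + 1) (by omega)]

theorem mono (h : IsRowChain n L g) {s t : ℕ} (hst : s ≤ t) (x : ℕ) : g s x ≤ g t x :=
  monotone_nat_of_le_succ (f := fun s => g s x) (fun s => h.le_succ s x) hst

theorem le_last (h : IsRowChain n L g) (s x : ℕ) : g s x ≤ n - 1 - x := by
  rw [← h.last (max s L) (le_max_right _ _)]
  exact h.mono (le_max_left _ _) x

theorem antitone (h : IsRowChain n L g) (s : ℕ) : Antitone (g s) := by
  rcases le_total L s with hs | hs
  · intro x y hxy
    rw [h.last s hs, h.last s hs]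
    omega
  · induction s with
    | zero =>
      intro x y _
      rw [h.zero, h.zero]
    | succ s ih =>
      obtain ⟨e, d, hm⟩ := h.step s hs
      exact hm.antitone_left (ih (by omega))

/-- If the prime path of row `k` ends above the first row, then this was the case at all earlier
times. -/
theorem below_of_le (h : IsRowChain n L g) {k s t : ℕ} (hst : s ≤ t)
    (ht : ∀ x < k, g t x + x < g t k + k) : ∀ x < k, g s x + x < g s k + k := by
  induction t, hst using Nat.le_induction with
  | base => exact ht
  | succ t hst ih =>
    apply ih
    intro x hx
    have h₀ := ht x hx
    rcases lt_or_ge t L with htL | htL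
    · obtain ⟨e, d, hm⟩ := h.step t htL
      have hle := hm.anti_le x
      by_cases hk : e ≤ k ∧ k ≤ d
      · have he := hm.eq_zero hk.1 hk.2 ht
        have h₁ := hm.rows_mem hk.1 hk.2
        have h₂ := hm.rows_mem (x := x) (by omega) (by omega)
        omega
      · have h₁ := hm.rows_notMem hk
        omega
    · rw [h.last t htL, h.last t htL]
      rw [h.last _ (by omega), h.last _ (by omega)] at h₀
      exact h₀

theorem full_of_le (h : IsRowChain n L g) {k s t : ℕ} (hst : s ≤ t)
    (hk : g s k + k + 1 = n) : g t k + k + 1 = n := by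
  have h₁ := h.mono hst k
  have h₂ := h.le_last t k
  omega

/-- No strip contains a row that was full before. -/
theorem notMem_of_full {k s e d : ℕ} (h : IsRowChain n L g)
    (hk : g s k + k + 1 = n) (hm : IsStripRemoval (g (s + 1)) (g s) e d) : ¬ (e ≤ k ∧ k ≤ d) := by
  intro hkd
  have h₁ := hm.rows_mem hkd.1 hkd.2
  have h₂ := h.full_of_le (Nat.le_add_right s 1) hk
  omega

theorem bounds_of_mem_plusLabels (h : IsRowChain n L g) {j : ℕ} (hj : j ∈ plusLabels n g) :
    1 ≤ j ∧ j ≤ L := by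
  obtain ⟨k, -, -, h₁, h₂, -⟩ := hj
  constructor
  · by_contra hj
    obtain rfl : j = 0 := by omega
    rw [Nat.zero_sub] at h₂
    omega
  · by_contra hj
    rw [h.last _ (by omega)] at h₁ h₂
    omega

/-- If row `k` becomes full while no earlier row is full, then the strip that fills it consists of
one box in each of the rows `0, …, k`. -/
theorem strip_of_full (h : IsRowChain n L g) {k s e d : ℕ}
    (hm : IsStripRemoval (g (s + 1)) (g s) e d)
    (hlt : ∀ x < k, g (s + 1) x + x + 1 < n) (h₁ : g (s + 1) k + k + 1 = n)
    (h₂ : g s k + k + 1 < n) : e = 0 ∧ d = k := by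
  have hkd : e ≤ k ∧ k ≤ d := by
    by_contra hkd
    have := hm.rows_notMem hkd
    omega
  refine ⟨hm.eq_zero hkd.1 hkd.2 fun x hx => by have := hlt x hx; omega, ?_⟩
  by_contra hne
  have h₃ := hm.below k hkd.1 (by omega)
  have h₄ := h.le_last (s + 1) d
  have h₅ := hm.corner
  omega

end IsRowChain

/-! ### Insertion and deletion of plus-full-sets -/

/-- The first full row of a sequence of row lengths. -/
noncomputable def firstFull (n : ℕ) (f : ℕ → ℕ) : ℕ := sInf {x | f x + x + 1 = n}

theorem IsRowChain.firstFull_spec {n L : ℕ} {g : ℕ → ℕ → ℕ} (h : IsRowChain n L g) (hn : 1 ≤ n)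
    (s : ℕ) : g s (firstFull n (g s)) + firstFull n (g s) + 1 = n ∧
      ∀ x < firstFull n (g s), g s x + x + 1 < n := by
  have hne : {x | g s x + x + 1 = n}.Nonempty := by
    refine ⟨n - 1, ?_⟩
    have := h.le_last s (n - 1)
    show _ + _ + 1 = n
    omega
  have h₁ := Nat.sInf_mem hne
  refine ⟨h₁, fun x hx => ?_⟩
  have h₂ : g s x + x + 1 ≠ n :=
    Nat.notMem_of_lt_sInf (s := {x | g s x + x + 1 = n}) hx
  have h₃ := h.le_last s x
  have h₄ : g s (firstFull n (g s)) + firstFull n (g s) + 1 = n := h₁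
  omega

theorem firstFull_eq {n k : ℕ} {f : ℕ → ℕ} (hk : f k + k + 1 = n)
    (hlt : ∀ x < k, f x + x + 1 < n) : firstFull n f = k := by
  refine le_antisymm (Nat.sInf_le hk) (le_of_not_gt fun hx => ?_)
  have h₁ := hlt _ hx
  have h₂ : f (firstFull n f) + firstFull n f + 1 = n :=
    Nat.sInf_mem (s := {x | f x + x + 1 = n}) ⟨k, hk⟩
  omega

/-- Insertion of an `r`-set that ends in row `k`: at the times before `r`, row `k` is doubled, and
from time `r` on there is an additional box in each of the rows `0, …, k`. -/
def insertSet (r k : ℕ) (g : ℕ → ℕ → ℕ) : ℕ → ℕ → ℕ := fun s x =>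
  g (if s < r then s else s - 1) (if x ≤ k then x else x - 1) + if r ≤ s ∧ x ≤ k then 1 else 0

section insertSet

variable {r k s x : ℕ} (g : ℕ → ℕ → ℕ)

theorem insertSet_lt_le (hs : s < r) (hx : x ≤ k) : insertSet r k g s x = g s x := by
  simp [insertSet, hs, hx, not_le.2 hs]

theorem insertSet_lt_gt (hs : s < r) (hx : k < x) : insertSet r k g s x = g s (x - 1) := by
  simp [insertSet, hs, not_le.2 hx]

theorem insertSet_ge_le (hs : r ≤ s) (hx : x ≤ k) :
    insertSet r k g s x = g (s - 1) x + 1 := by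
  simp [insertSet, hs, hx, not_lt.2 hs]

theorem insertSet_ge_gt (hs : r ≤ s) (hx : k < x) :
    insertSet r k g s x = g (s - 1) (x - 1) := by
  simp [insertSet, not_lt.2 hs, not_le.2 hx]

end insertSet

/-- Deletion of an `r`-set that ends in row `k`, inverse to `insertSet r k`. -/
def deleteSet (r k : ℕ) (g : ℕ → ℕ → ℕ) : ℕ → ℕ → ℕ := fun s x =>
  g (if s < r then s else s + 1) (if x ≤ k then x else x + 1) - if r ≤ s ∧ x ≤ k then 1 else 0

section deleteSet

variable {r k s x : ℕ} (g : ℕ → ℕ → ℕ)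

theorem deleteSet_lt_le (hs : s < r) (hx : x ≤ k) : deleteSet r k g s x = g s x := by
  simp [deleteSet, hs, hx, not_le.2 hs]

theorem deleteSet_lt_gt (hs : s < r) (hx : k < x) : deleteSet r k g s x = g s (x + 1) := by
  simp [deleteSet, hs, not_le.2 hx]

theorem deleteSet_ge_le (hs : r ≤ s) (hx : x ≤ k) :
    deleteSet r k g s x = g (s + 1) x - 1 := by
  simp [deleteSet, hs, hx, not_lt.2 hs]

theorem deleteSet_ge_gt (hs : r ≤ s) (hx : k < x) :
    deleteSet r k g s x = g (s + 1) (x + 1) := by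
  simp [deleteSet, not_lt.2 hs, not_le.2 hx]

end deleteSet

namespace IsRowChain

variable {n L : ℕ} {g : ℕ → ℕ → ℕ}

/-- The insertion of a plus-full-set with end-box in the first row `k` that is full at time
`r - 1` yields a chain. -/
theorem insertSet (h : IsRowChain n L g) {r k : ℕ} (hr : 1 ≤ r) (hrL : r ≤ L + 1)
    (hk : g (r - 1) k + k + 1 = n) (hlt : ∀ x < k, g (r - 1) x + x + 1 < n) :
    IsRowChain (n + 1) (L + 1) (insertSet r k g) where
  zero x := by
    rcases le_or_gt x k with hx | hx
    · rw [insertSet_lt_le g (by omega) hx, h.zero]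
    · rw [insertSet_lt_gt g (by omega) hx, h.zero]
  last s hs x := by
    rcases le_or_gt x k with hx | hx
    · rw [insertSet_ge_le g (by omega) hx, h.last _ (by omega)]
      omega
    · rw [insertSet_ge_gt g (by omega) hx, h.last _ (by omega)]
      omega
  step s hs := by
    rcases lt_trichotomy (s + 1) r with hsr | hsr | hsr
    · -- Before time `r`, each strip that contains row `k` goes up to the first row.
      have hv₁ : ∀ x ≤ k, Tamari.insertSet r k g (s + 1) x = g (s + 1) x :=
        fun x hx => insertSet_lt_le g (by omega) hx
      have hv₂ : ∀ x, k < x → Tamari.insertSet r k g (s + 1) x = g (s + 1) (x - 1) :=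
        fun x hx => insertSet_lt_gt g (by omega) hx
      have hv₃ : ∀ x ≤ k, Tamari.insertSet r k g s x = g s x :=
        fun x hx => insertSet_lt_le g (by omega) hx
      have hv₄ : ∀ x, k < x → Tamari.insertSet r k g s x = g s (x - 1) :=
        fun x hx => insertSet_lt_gt g (by omega) hx
      have hbel : ∀ x < k, g (s + 1) x + x < g (s + 1) k + k :=
        h.below_of_le (t := r - 1) (by omega) fun x hx => by have := hlt x hx; omega
      obtain ⟨e, d, hm⟩ := h.step s (by omega)
      have hle := hm.le
      have hc := hm.corner
      rcases lt_or_ge d k with hdk | hdk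
      · refine ⟨e, d, hle, ?_, ?_, ?_, ?_⟩
        · rwa [hv₁ _ (by omega), hv₁ _ (by omega)]
        · intro x h₁ h₂
          rw [hv₁ _ (by omega), hv₁ _ (by omega)]
          exact hm.below x h₁ h₂
        · intro x h₁
          rw [hv₁ _ (by omega), hv₁ _ (by omega)]
          exact hm.ret x h₁
        · intro x
          rcases le_or_gt x k with hx | hx
          · rw [hv₁ x hx, hv₃ x hx]
            exact hm.rows x
          · rw [hv₂ x hx, hv₄ x hx, hm.rows_notMem (by omega), if_neg (by omega), add_zero]
      rcases lt_or_ge k e with hek | hek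
      · refine ⟨e + 1, d + 1, by omega, ?_, ?_, ?_, ?_⟩
        · rwa [hv₂ _ (by omega), hv₂ _ (by omega)]
        · intro x h₁ h₂
          rw [hv₂ _ (by omega), hv₂ _ (by omega), Nat.add_sub_cancel]
          have := hm.below (x - 1) (by omega) (by omega)
          omega
        · intro x h₁
          rw [hv₂ _ (by omega), hv₂ _ (by omega), Nat.add_sub_cancel]
          have := hm.ret (x - 1) (by omega)
          omega
        · intro x
          rcases le_or_gt x k with hx | hx
          · rw [hv₁ x hx, hv₃ x hx, hm.rows_notMem (by omega), if_neg (by omega), add_zero]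
          · rw [hv₂ x hx, hv₄ x hx, hm.rows (x - 1)]
            congr 1
            exact if_congr (by omega) rfl rfl
      · obtain rfl := hm.eq_zero hek hdk hbel
        refine ⟨0, d + 1, by omega, ?_, ?_, by omega, ?_⟩
        · rwa [hv₂ _ (by omega), hv₂ _ (by omega)]
        · intro x h₁ h₂
          rw [hv₂ (d + 1) (by omega), Nat.add_sub_cancel]
          rcases le_or_gt x k with hx | hx
          · rw [hv₁ x hx]
            have := hm.below_le (x := x) (by omega) (by omega)
            omega
          · rw [hv₂ x hx]
            have := hm.below (x - 1) (by omega) (by omega)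
            omega
        · intro x
          rcases le_or_gt x k with hx | hx
          · rw [hv₁ x hx, hv₃ x hx, hm.rows_mem (by omega) (by omega), if_pos (by omega)]
          · rw [hv₂ x hx, hv₄ x hx, hm.rows (x - 1)]
            congr 1
            exact if_congr (by omega) rfl rfl
    · -- The inserted `r`-set is the strip of row `k`.
      have hs' : s = r - 1 := by omega
      have hv₁ : ∀ x ≤ k, Tamari.insertSet r k g (s + 1) x = g s x + 1 :=
        fun x hx => insertSet_ge_le g (by omega) hx
      have hv₂ : ∀ x, k < x → Tamari.insertSet r k g (s + 1) x = g s (x - 1) :=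
        fun x hx => insertSet_ge_gt g (by omega) hx
      have hv₃ : ∀ x ≤ k, Tamari.insertSet r k g s x = g s x :=
        fun x hx => insertSet_lt_le g (by omega) hx
      have hv₄ : ∀ x, k < x → Tamari.insertSet r k g s x = g s (x - 1) :=
        fun x hx => insertSet_lt_gt g (by omega) hx
      rw [← hs'] at hk hlt
      refine ⟨0, k, by omega, ?_, ?_, by omega, ?_⟩
      · rw [hv₂ _ (by omega), hv₁ _ le_rfl, Nat.add_sub_cancel]
        omega
      · intro x _ hx
        rw [hv₁ _ le_rfl, hv₁ _ hx.le]
        have := hlt x hx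
        omega
      · intro x
        rcases le_or_gt x k with hx | hx
        · rw [hv₁ x hx, hv₃ x hx, if_pos (by omega)]
        · rw [hv₂ x hx, hv₄ x hx, if_neg (by omega), add_zero]
    · -- From time `r` on, row `k` of the given chain is full, so that no strip contains it.
      obtain ⟨s, rfl⟩ : ∃ t, s = t + 1 := ⟨s - 1, by omega⟩
      have hv₁ : ∀ x ≤ k, Tamari.insertSet r k g (s + 1 + 1) x = g (s + 1) x + 1 :=
        fun x hx => insertSet_ge_le g (by omega) hx
      have hv₂ : ∀ x, k < x → Tamari.insertSet r k g (s + 1 + 1) x = g (s + 1) (x - 1) :=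
        fun x hx => insertSet_ge_gt g (by omega) hx
      have hv₃ : ∀ x ≤ k, Tamari.insertSet r k g (s + 1) x = g s x + 1 :=
        fun x hx => insertSet_ge_le g (by omega) hx
      have hv₄ : ∀ x, k < x → Tamari.insertSet r k g (s + 1) x = g s (x - 1) :=
        fun x hx => insertSet_ge_gt g (by omega) hx
      obtain ⟨e, d, hm⟩ := h.step s (by omega)
      have hnot := h.notMem_of_full (h.full_of_le (t := s) (by omega) hk) hm
      have hle := hm.le
      have hc := hm.corner
      rcases lt_or_ge d k with hdk | hdk
      · refine ⟨e, d, hle, ?_, ?_, ?_, ?_⟩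
        · rw [hv₁ _ (by omega), hv₁ _ (by omega)]
          omega
        · intro x h₁ h₂
          rw [hv₁ _ (by omega), hv₁ _ (by omega)]
          have := hm.below x h₁ h₂
          omega
        · intro x h₁
          rw [hv₁ _ (by omega), hv₁ _ (by omega)]
          have := hm.ret x h₁
          omega
        · intro x
          rcases le_or_gt x k with hx | hx
          · rw [hv₁ x hx, hv₃ x hx, hm.rows x, add_right_comm]
          · rw [hv₂ x hx, hv₄ x hx, hm.rows_notMem (by omega), if_neg (by omega), add_zero]
      · refine ⟨e + 1, d + 1, by omega, ?_, ?_, ?_, ?_⟩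
        · rwa [hv₂ _ (by omega), hv₂ _ (by omega)]
        · intro x h₁ h₂
          rw [hv₂ _ (by omega), hv₂ _ (by omega), Nat.add_sub_cancel]
          have := hm.below (x - 1) (by omega) (by omega)
          omega
        · intro x h₁
          rw [hv₂ _ (by omega), hv₂ _ (by omega), Nat.add_sub_cancel]
          have := hm.ret (x - 1) (by omega)
          omega
        · intro x
          rcases le_or_gt x k with hx | hx
          · rw [hv₁ x hx, hv₃ x hx, hm.rows_notMem (by omega), if_neg (by omega), add_zero]
          · rw [hv₂ x hx, hv₄ x hx, hm.rows (x - 1)]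
            congr 1
            exact if_congr (by omega) rfl rfl

/-- Two adjacent rows that are equal at some time were equal at all earlier times. -/
theorem eq_succ_of_le (h : IsRowChain n L g) {k s t : ℕ} (hst : s ≤ t) (htL : t ≤ L)
    (ht : g t (k + 1) = g t k) : g s (k + 1) = g s k := by
  induction t, hst using Nat.le_induction with
  | base => exact ht
  | succ t hst ih =>
    refine ih (by omega) ?_
    obtain ⟨e, d, hm⟩ := h.step t (by omega)
    have hle := hm.le
    have hc := hm.corner
    have hdk : d ≠ k := by
      rintro rfl
      omega
    have h₁ := hm.rows k
    have h₂ := hm.rows (k + 1)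
    have hek : e ≠ k + 1 := by
      rintro rfl
      have h₃ := hm.ret k rfl
      have h₄ := hm.below_le le_rfl hle
      omega
    split_ifs at h₁ h₂ <;> omega

/-- The deletion of a plus-full-set yields a chain, from which the insertion recovers the given
chain. -/
theorem deleteSet (h : IsRowChain (n + 1) (L + 1) g) {r k : ℕ} (hr : 1 ≤ r) (hrL : r ≤ L + 1)
    (hkn : k + 2 ≤ n + 1) (hlt : ∀ x < k, g r x + x + 1 < n + 1) (hk : g r k + k + 1 = n + 1)
    (hk' : g (r - 1) k + k + 1 < n + 1) (hk₁ : g (r - 1) (k + 1) + k + 2 = n + 1) :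
    IsRowChain n L (deleteSet r k g) ∧ Tamari.insertSet r k (deleteSet r k g) = g ∧
      firstFull n (deleteSet r k g (r - 1)) = k := by
  obtain ⟨r, rfl⟩ : ∃ t, r = t + 1 := ⟨r - 1, by omega⟩
  rw [Nat.add_sub_cancel] at hk' hk₁ ⊢
  obtain ⟨e, d, hm⟩ := h.step r (by omega)
  -- From here on `r + 1` is the label, and `d` is the row `k` of the end-box.
  obtain ⟨rfl, rfl⟩ := h.strip_of_full hm hlt hk hk'
  have hin : ∀ x ≤ d, g (r + 1) x = g r x + 1 := fun x hx => hm.rows_mem (by omega) hx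
  have hout : ∀ x, d < x → g (r + 1) x = g r x := fun x hx => hm.rows_notMem (by omega)
  have heq : ∀ s ≤ r, g s (d + 1) = g s d := fun s hs =>
    h.eq_succ_of_le hs (by omega) (by have := hin d le_rfl; omega)
  have hbel : ∀ s ≤ r + 1, ∀ x < d, g s x + x < g s d + d := fun s hs =>
    h.below_of_le hs fun x hx => by have := hlt x hx; omega
  have hpos : ∀ s, r < s → ∀ x ≤ d, 1 ≤ g s x := fun s hs x hx => by
    have h₁ := hin x hx
    have h₂ := h.mono (s := r + 1) (t := s) hs x
    omega
  -- At time `r`, the two descriptions of `deleteSet` agree.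
  have hle : ∀ s, r ≤ s → ∀ x ≤ d, Tamari.deleteSet (r + 1) d g s x = g (s + 1) x - 1 := by
    intro s hs x hx
    rcases hs.eq_or_lt with rfl | hs
    · rw [deleteSet_lt_le g (by omega) hx, hin x hx, Nat.add_sub_cancel]
    · exact deleteSet_ge_le g (by omega) hx
  have hgt : ∀ s, r ≤ s → ∀ x, d < x → Tamari.deleteSet (r + 1) d g s x = g (s + 1) (x + 1) := by
    intro s hs x hx
    rcases hs.eq_or_lt with rfl | hs
    · rw [deleteSet_lt_gt g (by omega) hx, hout _ (by omega)]
    · exact deleteSet_ge_gt g (by omega) hx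
  refine ⟨⟨?_, ?_, ?_⟩, ?_, ?_⟩
  · intro x
    rcases le_or_gt x d with hx | hx
    · rw [deleteSet_lt_le g (by omega) hx, h.zero]
    · rw [deleteSet_lt_gt g (by omega) hx, h.zero]
  · intro s hs
    rcases lt_or_ge s r with hsr | hsr
    · -- At the times up to `r`, the rows `d` and `d + 1` agree, so that a strip contains both or none.
      have hv₁ : ∀ x ≤ d, Tamari.deleteSet (r + 1) d g (s + 1) x = g (s + 1) x :=
        fun x hx => deleteSet_lt_le g (by omega) hx
      have hv₂ : ∀ x, d < x → Tamari.deleteSet (r + 1) d g (s + 1) x = g (s + 1) (x + 1) :=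
        fun x hx => deleteSet_lt_gt g (by omega) hx
      have hv₃ : ∀ x ≤ d, Tamari.deleteSet (r + 1) d g s x = g s x :=
        fun x hx => deleteSet_lt_le g (by omega) hx
      have hv₄ : ∀ x, d < x → Tamari.deleteSet (r + 1) d g s x = g s (x + 1) :=
        fun x hx => deleteSet_lt_gt g (by omega) hx
      -- Since rows `d` and `d + 1` agree, this also holds for `x = d`.
      have hv₅ : ∀ x, d ≤ x → Tamari.deleteSet (r + 1) d g (s + 1) x = g (s + 1) (x + 1) := by
        intro x hx
        rcases hx.eq_or_lt with rfl | hx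
        · rw [hv₁ _ le_rfl, heq _ (by omega)]
        · exact hv₂ x hx
      have heq₁ := heq (s + 1) (by omega)
      obtain ⟨a, b, hab⟩ := h.step s (by omega)
      have hle' := hab.le
      have hc := hab.corner
      have hbd : b ≠ d := by
        rintro rfl
        omega
      rcases lt_or_gt_of_ne hbd with hbd | hbd
      · refine ⟨a, b, hle', ?_, ?_, ?_, ?_⟩
        · rwa [hv₁ _ (by omega), hv₁ _ (by omega)]
        · intro x h₁ h₂
          rw [hv₁ _ (by omega), hv₁ _ (by omega)]
          exact hab.below x h₁ h₂
        · intro x h₁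
          rw [hv₁ _ (by omega), hv₁ _ (by omega)]
          exact hab.ret x h₁
        · intro x
          rcases le_or_gt x d with hx | hx
          · rw [hv₁ x hx, hv₃ x hx]
            exact hab.rows x
          · rw [hv₂ x hx, hv₄ x hx, hab.rows_notMem (by omega), if_neg (by omega), add_zero]
      have had : a ≠ d + 1 := by
        rintro rfl
        have h₃ := hab.ret d rfl
        have h₄ := hab.below_le le_rfl hle'
        omega
      rcases lt_or_ge d a with had' | had'
      · refine ⟨a - 1, b - 1, by omega, ?_, ?_, ?_, ?_⟩
        · rw [hv₅ _ (by omega), hv₅ _ (by omega), Nat.sub_add_cancel (by omega)]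
          exact hc
        · intro x h₁ h₂
          rw [hv₅ _ (by omega), hv₅ _ (by omega), Nat.sub_add_cancel (by omega)]
          have := hab.below (x + 1) (by omega) (by omega)
          omega
        · intro x h₁
          rw [hv₅ _ (by omega), hv₅ _ (by omega), Nat.sub_add_cancel (by omega)]
          have := hab.ret (x + 1) (by omega)
          omega
        · intro x
          rcases le_or_gt x d with hx | hx
          · rw [hv₁ x hx, hv₃ x hx, hab.rows_notMem (by omega), if_neg (by omega), add_zero]
          · rw [hv₂ x hx, hv₄ x hx, hab.rows (x + 1)]
            congr 1
            exact if_congr (by omega) rfl rfl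
      · obtain rfl := hab.eq_zero had' hbd.le (hbel _ (by omega))
        refine ⟨0, b - 1, by omega, ?_, ?_, by omega, ?_⟩
        · rw [hv₅ _ (by omega), hv₅ _ (by omega), Nat.sub_add_cancel (by omega)]
          exact hc
        · intro x h₁ h₂
          rw [hv₅ (b - 1) (by omega), Nat.sub_add_cancel (by omega)]
          rcases lt_or_ge x d with hx | hx
          · rw [hv₁ x hx.le]
            have h₃ := hbel (s + 1) (by omega) x hx
            have h₄ := hab.below_le (x := d + 1) (by omega) (by omega)
            omega
          · rw [hv₅ x hx]
            have := hab.below (x + 1) (by omega) (by omega)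
            omega
        · intro x
          rcases le_or_gt x d with hx | hx
          · rw [hv₁ x hx, hv₃ x hx, hab.rows_mem (by omega) (by omega), if_pos (by omega)]
          · rw [hv₂ x hx, hv₄ x hx, hab.rows (x + 1)]
            congr 1
            exact if_congr (by omega) rfl rfl
    · -- From time `r + 1` on, the rows `d` and `d + 1` are full, and no strip contains one of them.
      have hv₁ := hle (s + 1) (by omega)
      have hv₂ := hgt (s + 1) (by omega)
      have hv₃ := hle s hsr
      have hv₄ := hgt s hsr
      have hf₁ : g (s + 1 + 1) d + d + 1 = n + 1 := h.full_of_le (s := r + 1) (by omega) hk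
      have hf₂ : g (s + 1 + 1) (d + 1) + (d + 1) + 1 = n + 1 :=
        h.full_of_le (s := r) (by omega) (by omega)
      have hv₅ : ∀ x, d ≤ x →
          Tamari.deleteSet (r + 1) d g (s + 1) x = g (s + 1 + 1) (x + 1) := by
        intro x hx
        rcases hx.eq_or_lt with rfl | hx
        · rw [hv₁ _ le_rfl]
          omega
        · exact hv₂ x hx
      obtain ⟨a, b, hab⟩ := h.step (s + 1) (by omega)
      have hnot := h.notMem_of_full (h.full_of_le (t := s + 1) (by omega) hk) hab
      have hnot' := h.notMem_of_full (k := d + 1)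
        (h.full_of_le (s := r) (t := s + 1) (by omega) (by omega)) hab
      have hle' := hab.le
      have hc := hab.corner
      rcases lt_or_ge b d with hbd | hbd
      · refine ⟨a, b, hle', ?_, ?_, ?_, ?_⟩
        · rw [hv₁ _ (by omega), hv₁ _ (by omega)]
          have := hpos (s + 1 + 1) (by omega) (b + 1) (by omega)
          omega
        · intro x h₁ h₂
          rw [hv₁ _ (by omega), hv₁ _ (by omega)]
          have := hab.below x h₁ h₂
          have := hpos (s + 1 + 1) (by omega) x (by omega)
          have := hpos (s + 1 + 1) (by omega) b (by omega)
          omega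
        · intro x h₁
          rw [hv₁ _ (by omega), hv₁ _ (by omega)]
          have := hab.ret x h₁
          omega
        · intro x
          rcases le_or_gt x d with hx | hx
          · rw [hv₁ x hx, hv₃ x hx, hab.rows x, Nat.sub_add_comm (hpos _ (by omega) x hx)]
          · rw [hv₂ x hx, hv₄ x hx, hab.rows_notMem (by omega), if_neg (by omega), add_zero]
      · refine ⟨a - 1, b - 1, by omega, ?_, ?_, ?_, ?_⟩
        · rw [hv₅ _ (by omega), hv₅ _ (by omega), Nat.sub_add_cancel (by omega)]
          exact hc
        · intro x h₁ h₂
          rw [hv₅ _ (by omega), hv₅ _ (by omega), Nat.sub_add_cancel (by omega)]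
          have := hab.below (x + 1) (by omega) (by omega)
          omega
        · intro x h₁
          rw [hv₅ _ (by omega), hv₅ _ (by omega), Nat.sub_add_cancel (by omega)]
          have := hab.ret (x + 1) (by omega)
          omega
        · intro x
          rcases le_or_gt x d with hx | hx
          · rw [hv₁ x hx, hv₃ x hx, hab.rows_notMem (by omega), if_neg (by omega), add_zero]
          · rw [hv₂ x hx, hv₄ x hx, hab.rows (x + 1)]
            congr 1
            exact if_congr (by omega) rfl rfl
  · intro s hs x
    rcases le_or_gt x d with hx | hx
    · rw [hle s (by omega) x hx, h.last _ (by omega)]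
      omega
    · rw [hgt s (by omega) x hx, h.last _ (by omega)]
      omega
  · funext s x
    rcases lt_or_ge s (r + 1) with hs | hs
    · rcases le_or_gt x d with hx | hx
      · rw [insertSet_lt_le _ hs hx, deleteSet_lt_le _ hs hx]
      · rw [insertSet_lt_gt _ hs hx]
        rcases eq_or_lt_of_le (Nat.succ_le_of_lt hx) with rfl | hx'
        · rw [Nat.succ_sub_one, deleteSet_lt_le _ hs le_rfl, heq s (by omega)]
        · rw [deleteSet_lt_gt _ hs (by omega), Nat.sub_add_cancel (by omega)]
    · rcases le_or_gt x d with hx | hx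
      · rw [insertSet_ge_le _ hs hx, hle _ (by omega) x hx,
          Nat.sub_add_cancel (show 1 ≤ s by omega), Nat.sub_add_cancel (hpos s (by omega) x hx)]
      · rw [insertSet_ge_gt _ hs hx]
        rcases eq_or_lt_of_le (Nat.succ_le_of_lt hx) with rfl | hx'
        · rw [Nat.succ_sub_one, hle _ (by omega) d le_rfl, Nat.sub_add_cancel (by omega)]
          have h₁ : g s d + d + 1 = n + 1 := h.full_of_le (s := r + 1) (by omega) hk
          have h₂ : g s (d + 1) + (d + 1) + 1 = n + 1 :=
            h.full_of_le (s := r) (by omega) (by omega)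
          show _ = g s (d + 1)
          omega
        · rw [hgt _ (by omega) _ (by omega), Nat.sub_add_cancel (by omega),
            Nat.sub_add_cancel (by omega)]
  · apply firstFull_eq
    · rw [deleteSet_lt_le _ (by omega) le_rfl]
      have := heq r le_rfl
      omega
    · intro x hx
      rw [deleteSet_lt_le _ (by omega) hx.le]
      have h₁ := hlt x hx
      have h₂ := hin x hx.le
      omega

/-! ### The effect of the insertion on the labels -/

section labels

variable {r k : ℕ}

theorem _root_.Tamari.mem_plusLabels_insertSet_self (hr : 1 ≤ r)
    (hk : g (r - 1) k + k + 1 = n) (hlt : ∀ x < k, g (r - 1) x + x + 1 < n) :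
    r ∈ plusLabels (n + 1) (Tamari.insertSet r k g) := by
  refine ⟨k, by omega, fun x hx => ?_, ?_, ?_, ?_⟩
  · rw [insertSet_ge_le g le_rfl hx.le]
    have := hlt x hx
    omega
  · rw [insertSet_ge_le g le_rfl le_rfl]
    omega
  · rw [insertSet_lt_le g (by omega) le_rfl]
    omega
  · rw [insertSet_lt_gt g (by omega) (by omega), Nat.add_sub_cancel]
    omega

theorem mem_plusLabels_insertSet_of_lt (h : IsRowChain n L g)
    (hk : g (r - 1) k + k + 1 = n) (hlt : ∀ x < k, g (r - 1) x + x + 1 < n) {j : ℕ} (hj : j < r) :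
    j ∈ plusLabels (n + 1) (Tamari.insertSet r k g) ↔ j ∈ plusLabels n g := by
  have hlt' : ∀ s < r, ∀ x < k, g s x + x + 1 < n := fun s hs x hx => by
    have h₁ := hlt x hx
    have h₂ := h.mono (s := s) (t := r - 1) (by omega) x
    omega
  have hb : ∀ x ≤ k, ∀ s, g s x + x + 1 ≤ n := fun x hx s => by
    have := h.le_last s x
    omega
  constructor
  · rintro ⟨l, h₁, h₂, h₃, h₄, h₅⟩
    have hkl : k < l := by
      by_contra hkl
      rw [insertSet_lt_le g hj (by omega)] at h₃
      have := hb l (by omega) j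
      omega
    rw [insertSet_lt_gt g hj hkl] at h₃
    rw [insertSet_lt_gt g (by omega) hkl] at h₄
    rw [insertSet_lt_gt g (by omega) (by omega)] at h₅
    refine ⟨l - 1, by omega, fun x hx => ?_, by omega, by omega, ?_⟩
    · rcases lt_or_ge x k with hxk | hxk
      · exact hlt' j hj x hxk
      · have := h₂ (x + 1) (by omega)
        rw [insertSet_lt_gt g hj (by omega), Nat.add_sub_cancel] at this
        omega
    · rw [Nat.sub_add_cancel (by omega)]
      rw [Nat.add_sub_cancel] at h₅
      omega
  · rintro ⟨l, h₁, h₂, h₃, h₄, h₅⟩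
    have hkl : k ≤ l := by
      by_contra hkl
      have := hlt' j hj l (by omega)
      omega
    refine ⟨l + 1, by omega, fun x hx => ?_, ?_, ?_, ?_⟩
    · rcases le_or_gt x k with hxk | hxk
      · rw [insertSet_lt_le g hj hxk]
        have := hb x hxk j
        omega
      · rw [insertSet_lt_gt g hj hxk]
        have := h₂ (x - 1) (by omega)
        omega
    · rw [insertSet_lt_gt g hj (by omega), Nat.add_sub_cancel]
      omega
    · rw [insertSet_lt_gt g (by omega) (by omega), Nat.add_sub_cancel]
      omega
    · rw [insertSet_lt_gt g (by omega) (by omega), Nat.add_sub_cancel]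
      omega

theorem mem_plusLabels_insertSet_succ (h : IsRowChain n L g) (hr : 1 ≤ r)
    (hk : g (r - 1) k + k + 1 = n) {j : ℕ} (hj : r ≤ j) :
    j + 1 ∈ plusLabels (n + 1) (Tamari.insertSet r k g) ↔ j ∈ plusLabels n g := by
  have hf : ∀ s, r ≤ s + 1 → g s k + k + 1 = n := fun s hs =>
    h.full_of_le (s := r - 1) (by omega) hk
  have hf₁ := hf j (by omega)
  have hf₂ := hf (j - 1) (by omega)
  constructor
  · rintro ⟨l, h₁, h₂, h₃, h₄, h₅⟩
    rw [Nat.add_sub_cancel] at h₄ h₅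
    have hkl : l < k := by
      rcases lt_trichotomy l k with hkl | rfl | hkl
      · exact hkl
      · rw [insertSet_ge_le g hj le_rfl] at h₄
        omega
      · have := h₂ k hkl
        rw [insertSet_ge_le g (by omega) le_rfl, Nat.add_sub_cancel] at this
        omega
    rw [insertSet_ge_le g (by omega) (by omega), Nat.add_sub_cancel] at h₃
    rw [insertSet_ge_le g hj (by omega)] at h₄ h₅
    refine ⟨l, by omega, fun x hx => ?_, by omega, by omega, by omega⟩
    have := h₂ x hx
    rw [insertSet_ge_le g (by omega) (by omega), Nat.add_sub_cancel] at this
    omega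
  · rintro ⟨l, h₁, h₂, h₃, h₄, h₅⟩
    have hkl : l < k := by
      rcases lt_trichotomy l k with hkl | rfl | hkl
      · exact hkl
      · omega
      · have := h₂ k hkl
        omega
    refine ⟨l, by omega, fun x hx => ?_, ?_, ?_, ?_⟩
    · rw [insertSet_ge_le g (by omega) (by omega), Nat.add_sub_cancel]
      have := h₂ x hx
      omega
    · rw [insertSet_ge_le g (by omega) (by omega), Nat.add_sub_cancel]
      omega
    · rw [Nat.add_sub_cancel, insertSet_ge_le g hj (by omega)]
      omega
    · rw [Nat.add_sub_cancel, insertSet_ge_le g hj (by omega)]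
      omega

end labels

end IsRowChain

/-! ### The bijection, and the chains with given labels -/

/-- The insertion is undone by the deletion. -/
theorem deleteSet_insertSet (r k : ℕ) (g : ℕ → ℕ → ℕ) : deleteSet r k (insertSet r k g) = g := by
  funext s x
  rcases lt_or_ge s r with hs | hs <;> rcases le_or_gt x k with hx | hx
  · rw [deleteSet_lt_le _ hs hx, insertSet_lt_le _ hs hx]
  · rw [deleteSet_lt_gt _ hs hx, insertSet_lt_gt _ hs (by omega), Nat.add_sub_cancel]
  · rw [deleteSet_ge_le _ hs hx, insertSet_ge_le _ (by omega) hx, Nat.add_sub_cancel,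
      Nat.add_sub_cancel]
  · rw [deleteSet_ge_gt _ hs hx, insertSet_ge_gt _ (by omega) (by omega), Nat.add_sub_cancel,
      Nat.add_sub_cancel]

/-- The insertion of a plus-full-set with label `r` into a chain in the `n`-th Tamari lattice. The
row of its end-box has to be the first row that is full at time `r - 1`. -/
noncomputable def insertPlus (n r : ℕ) (g : ℕ → ℕ → ℕ) : ℕ → ℕ → ℕ :=
  insertSet r (firstFull n (g (r - 1))) g

variable {n L r : ℕ}

theorem insertPlus_injOn (hn : 1 ≤ n) :
    Set.InjOn (insertPlus n r) {g | IsRowChain n L g} := by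
  have key : ∀ g, IsRowChain n L g →
      firstFull (n + 1) (insertPlus n r g r) = firstFull n (g (r - 1)) := by
    intro g hg
    obtain ⟨hk, hlt⟩ := hg.firstFull_spec hn (r - 1)
    apply firstFull_eq
    · rw [insertPlus, insertSet_ge_le g le_rfl le_rfl]
      omega
    · intro x hx
      rw [insertPlus, insertSet_ge_le g le_rfl hx.le]
      have := hlt x hx
      omega
  intro g hg g' hg' heq
  have hk : firstFull n (g (r - 1)) = firstFull n (g' (r - 1)) := by
    rw [← key g hg, ← key g' hg', heq]
  rw [← deleteSet_insertSet r (firstFull n (g (r - 1))) g,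
    ← deleteSet_insertSet r (firstFull n (g (r - 1))) g']
  congr 1
  rw [insertPlus, insertPlus, ← hk] at heq
  exact heq

/-- Chains in the `n`-th Tamari lattice correspond to chains in the next one that are longer by one
and have a plus-full-set with a given label `r`. -/
theorem insertPlus_image (hn : 1 ≤ n) (hr : 1 ≤ r) (hrL : r ≤ L + 1) :
    insertPlus n r '' {g | IsRowChain n L g} =
      {g | IsRowChain (n + 1) (L + 1) g ∧ r ∈ plusLabels (n + 1) g} := by
  ext g
  constructor
  · rintro ⟨g, hg, rfl⟩
    obtain ⟨hk, hlt⟩ := IsRowChain.firstFull_spec hg hn (r - 1)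
    exact ⟨IsRowChain.insertSet hg hr hrL hk hlt, mem_plusLabels_insertSet_self hr hk hlt⟩
  · rintro ⟨hg, k, h₁, h₂, h₃, h₄, h₅⟩
    obtain ⟨h₆, h₇, h₈⟩ := hg.deleteSet hr hrL h₁ h₂ h₃ h₄ h₅
    refine ⟨deleteSet r k g, h₆, ?_⟩
    rw [insertPlus, h₈, h₇]

section labels

variable {g : ℕ → ℕ → ℕ} {U : Finset ℕ}

theorem IsRowChain.insert_subset_plusLabels_insertPlus (hg : IsRowChain n L g) (hn : 1 ≤ n)
    (hr : 1 ≤ r) (hU : ∀ u ∈ U, u < r) :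
    ((insert r U : Finset ℕ) : Set ℕ) ⊆ plusLabels (n + 1) (insertPlus n r g) ↔
      (U : Set ℕ) ⊆ plusLabels n g := by
  obtain ⟨hk, hlt⟩ := hg.firstFull_spec hn (r - 1)
  rw [Finset.coe_insert, Set.insert_subset_iff]
  constructor
  · rintro ⟨-, h⟩ u hu
    exact (hg.mem_plusLabels_insertSet_of_lt hk hlt (hU u hu)).1 (h hu)
  · intro h
    refine ⟨mem_plusLabels_insertSet_self hr hk hlt, fun u hu => ?_⟩
    exact (hg.mem_plusLabels_insertSet_of_lt hk hlt (hU u hu)).2 (h hu)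

theorem IsRowChain.plusLabels_insertPlus_eq_insert (hg : IsRowChain n L g) (hn : 1 ≤ n)
    (hr : 1 ≤ r) (hU : ∀ u ∈ U, u < r) :
    plusLabels (n + 1) (insertPlus n r g) = ((insert r U : Finset ℕ) : Set ℕ) ↔
      plusLabels n g = (U : Set ℕ) := by
  obtain ⟨hk, hlt⟩ := hg.firstFull_spec hn (r - 1)
  simp only [Set.ext_iff, Finset.coe_insert, Set.mem_insert_iff, Finset.mem_coe]
  constructor
  · intro h j
    rcases lt_or_ge j r with hj | hj
    · rw [← hg.mem_plusLabels_insertSet_of_lt hk hlt hj]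
      exact (h j).trans (or_iff_right hj.ne)
    · rw [← hg.mem_plusLabels_insertSet_succ hr hk hj]
      refine iff_of_false (fun hj' => ?_) fun hj' => absurd (hU j hj') (by omega)
      rcases (h (j + 1)).1 hj' with h' | h'
      · omega
      · have := hU _ h'
        omega
  · intro h j
    rcases lt_trichotomy j r with hj | rfl | hj
    · rw [or_iff_right hj.ne, ← h j]
      exact hg.mem_plusLabels_insertSet_of_lt hk hlt hj
    · exact iff_of_true (mem_plusLabels_insertSet_self hr hk hlt) (Or.inl rfl)
    · obtain ⟨j, rfl⟩ : ∃ t, j = t + 1 := ⟨j - 1, by omega⟩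
      have h₁ : j ∉ U := fun hj' => absurd (hU j hj') (by omega)
      have h₂ : ¬ (j + 1 = r ∨ j + 1 ∈ U) := by
        rintro (h' | h')
        · omega
        · have := hU _ h'
          omega
      refine iff_of_false (fun h' => h₁ ((h j).1 ?_)) h₂
      exact (hg.mem_plusLabels_insertSet_succ hr hk (by omega)).1 h'

end labels

/-- Transfer of a count along `insertPlus`. -/
theorem ncard_insertPlus (hn : 1 ≤ n) (hr : 1 ≤ r) (hrL : r ≤ L + 1)
    {p q : (ℕ → ℕ → ℕ) → Prop} (hp : ∀ g, p g → r ∈ plusLabels (n + 1) g)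
    (hpq : ∀ g, IsRowChain n L g → (p (insertPlus n r g) ↔ q g)) :
    {g | IsRowChain (n + 1) (L + 1) g ∧ p g}.ncard = {g | IsRowChain n L g ∧ q g}.ncard := by
  have himage : {g | IsRowChain (n + 1) (L + 1) g ∧ p g} =
      insertPlus n r '' {g | IsRowChain n L g ∧ q g} := by
    ext g
    constructor
    · rintro ⟨h₁, h₂⟩
      obtain ⟨g, h₃, rfl⟩ := (insertPlus_image hn hr hrL).ge ⟨h₁, hp g h₂⟩
      exact ⟨g, ⟨h₃, (hpq g h₃).1 h₂⟩, rfl⟩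
    · rintro ⟨g, ⟨h₁, h₂⟩, rfl⟩
      exact ⟨((insertPlus_image hn hr hrL).le ⟨g, h₁, rfl⟩).1, (hpq g h₁).2 h₂⟩
  rw [himage]
  exact ((insertPlus_injOn hn).mono fun g hg => hg.1).ncard_image

/-- Removing the plus-full-sets one by one, starting with the one of maximal label, does not
change the labels of the remaining ones. -/
theorem ncard_plusLabels (U : Finset ℕ) : ∀ n L : ℕ, U.card + 1 ≤ n → (∀ u ∈ U, 1 ≤ u ∧ u ≤ L) →
    {g | IsRowChain n L g ∧ (U : Set ℕ) ⊆ plusLabels n g}.ncard =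
      {g | IsRowChain (n - U.card) (L - U.card) g}.ncard ∧
    {g | IsRowChain n L g ∧ plusLabels n g = (U : Set ℕ)}.ncard =
      {g | IsRowChain (n - U.card) (L - U.card) g ∧ plusLabels (n - U.card) g = ∅}.ncard := by
  induction U using Finset.induction_on_max with
  | empty => simp
  | insert r U hU ih =>
    intro n L hn hL
    have hcard : (insert r U).card = U.card + 1 :=
      Finset.card_insert_of_notMem fun h => (hU r h).false
    rw [hcard] at hn ⊢
    have hr := hL r (Finset.mem_insert_self r U)
    obtain ⟨n, rfl⟩ : ∃ m, n = m + 1 := ⟨n - 1, by omega⟩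
    obtain ⟨L, rfl⟩ : ∃ m, L = m + 1 := ⟨L - 1, by omega⟩
    obtain ⟨h₁, h₂⟩ := ih n L (by omega) fun u hu =>
      ⟨(hL u (Finset.mem_insert_of_mem hu)).1, by have := hU u hu; omega⟩
    rw [Nat.add_sub_add_right, Nat.add_sub_add_right, ← h₁, ← h₂]
    refine ⟨ncard_insertPlus (by omega) hr.1 hr.2 ?_ ?_, ncard_insertPlus (by omega) hr.1 hr.2 ?_ ?_⟩
    · exact fun g h => h (by simp)
    · exact fun g hg => hg.insert_subset_plusLabels_insertPlus (by omega) hr.1 hU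
    · exact fun g h => h ▸ (by simp)
    · exact fun g hg => hg.plusLabels_insertPlus_eq_insert (by omega) hr.1 hU

theorem finite_isRowChain (n L : ℕ) : {g | IsRowChain n L g}.Finite := by
  refine Set.Finite.of_finite_image
    (f := fun (g : ℕ → ℕ → ℕ) (s : Fin L) (x : Fin n) => g s x) ?_ ?_
  · refine (Set.finite_Icc 0 fun _ _ => n).subset ?_
    rintro _ ⟨g, hg, rfl⟩
    refine ⟨fun _ _ => Nat.zero_le _, fun s x => ?_⟩
    have := IsRowChain.le_last hg s x
    show g s x ≤ n
    omega
  · intro g hg g' hg' heq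
    funext s x
    rcases lt_or_ge s L with hs | hs
    · rcases lt_or_ge x n with hx | hx
      · exact congr_fun (congr_fun heq ⟨s, hs⟩) ⟨x, hx⟩
      · have h₁ := IsRowChain.le_last hg s x
        have h₂ := IsRowChain.le_last hg' s x
        omega
    · rw [IsRowChain.last hg s hs, IsRowChain.last hg' s hs]

/-- There are at most `n - 1` plus-full-sets, since the label of a plus-full-set is the time at which
the row of its end-box becomes full. -/
theorem IsRowChain.card_le_of_subset_plusLabels {g : ℕ → ℕ → ℕ} (hg : IsRowChain n L g)
    {U : Finset ℕ} (hU : (U : Set ℕ) ⊆ plusLabels n g) : U.card ≤ n - 1 := by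
  choose! k hk using fun j (hj : j ∈ U) => hU hj
  rw [← Finset.card_range (n - 1)]
  refine Finset.card_le_card_of_injOn k (fun j hj => ?_) fun j hj j' hj' heq => ?_
  · have := (hk j hj).1
    simp only [Finset.coe_range, Set.mem_Iio]
    omega
  · have hne : ∀ i ∈ U, ∀ i' ∈ U, k i = k i' → ¬ i < i' := by
      intro i hi i' hi' hii hlt
      have h₁ := (hk i hi).2.2.1
      have h₂ := (hk i' hi').2.2.2.1
      rw [← hii] at h₂
      have h₃ := hg.mono (show i ≤ i' - 1 by omega) (k i)
      omega
    have h₁ := hne j hj j' hj' heq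
    have h₂ := hne j' hj' j hj heq.symm
    omega

/-! ### Double counting and inclusion-exclusion -/

section counting

/-- The sum over all subsets of a function that depends on the cardinality only, and vanishes for
large subsets. -/
theorem sum_powerset_eq_sum_range (A : Finset ℕ) (n : ℕ) (F : Finset ℕ → ℤ) (c : ℕ → ℤ)
    (hc : ∀ U ⊆ A, U.card < n → F U = c U.card) (h0 : ∀ U ⊆ A, n ≤ U.card → F U = 0) :
    ∑ U ∈ A.powerset, F U = ∑ t ∈ Finset.range n, (A.card.choose t : ℤ) * c t := by
  let c' : ℕ → ℤ := fun t => if t < n then c t else 0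
  have h₁ : ∑ U ∈ A.powerset, F U = ∑ U ∈ A.powerset, c' U.card := by
    refine Finset.sum_congr rfl fun U hU => ?_
    rw [Finset.mem_powerset] at hU
    by_cases hn : U.card < n
    · rw [hc U hU hn, show c' U.card = c U.card from if_pos hn]
    · rw [h0 U hU (by omega), show c' U.card = 0 from if_neg hn]
  have h₂ : ∑ t ∈ Finset.range n, (A.card.choose t : ℤ) * c t =
      ∑ t ∈ Finset.range n, A.card.choose t • c' t := by
    refine Finset.sum_congr rfl fun t ht => ?_
    rw [show c' t = c t from if_pos (Finset.mem_range.1 ht), nsmul_eq_mul]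
  rw [h₁, h₂, Finset.sum_powerset_apply_card]
  trans ∑ t ∈ Finset.range (A.card + 1 + n), A.card.choose t • c' t
  · refine Finset.sum_subset (fun t => by simp only [Finset.mem_range]; omega) fun t _ ht => ?_
    rw [Nat.choose_eq_zero_of_lt (by simp only [Finset.mem_range] at ht; omega), zero_smul]
  · refine (Finset.sum_subset (fun t => by simp only [Finset.mem_range]; omega)
      fun t _ ht => ?_).symm
    rw [show c' t = 0 from if_neg (by simpa using ht), smul_zero]

open Classical in
/-- Double counting and inclusion-exclusion: here `b U` counts the elements of `S` whose label set
contains `U`, and `a U` counts those whose label set is `U`. -/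
theorem card_eq_sum_and_card_eq_alternating_sum {α : Type*} (S : Finset α) (P : α → Finset ℕ)
    (A : Finset ℕ) (n : ℕ) (a b : ℕ → ℕ) (hPA : ∀ g ∈ S, P g ⊆ A) (hPn : ∀ g ∈ S, (P g).card < n)
    (ha : ∀ U ⊆ A, U.card < n → (S.filter fun g => P g = U).card = a U.card)
    (hb : ∀ U ⊆ A, U.card < n → (S.filter fun g => U ⊆ P g).card = b U.card) :
    (S.card : ℤ) = ∑ t ∈ Finset.range n, (A.card.choose t : ℤ) * a t ∧
    ((S.filter fun g => P g = ∅).card : ℤ) =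
      ∑ t ∈ Finset.range n, (A.card.choose t : ℤ) * ((-1) ^ t * b t) := by
  constructor
  · rw [Finset.card_eq_sum_card_fiberwise (f := P) (t := A.powerset)
      fun g hg => Finset.mem_coe.2 (Finset.mem_powerset.2 (hPA g hg)), Nat.cast_sum]
    refine sum_powerset_eq_sum_range A n _ _ (fun U hU hn => by rw [ha U hU hn]) fun U hU hn => ?_
    rw [Nat.cast_eq_zero, Finset.card_eq_zero, Finset.filter_eq_empty_iff]
    rintro g hg rfl
    exact absurd (hPn g hg) (by omega)
  · rw [← sum_powerset_eq_sum_range A n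
      (fun U => (-1) ^ U.card * ((S.filter fun g => U ⊆ P g).card : ℤ))
      _ (fun U hU hn => by rw [hb U hU hn])]
    · have h₁ : ∀ U : Finset ℕ, (-1 : ℤ) ^ U.card * ((S.filter fun g => U ⊆ P g).card : ℤ) =
          ∑ g ∈ S, if U ⊆ P g then (-1) ^ U.card else 0 := by
        intro U
        rw [← Finset.sum_filter, Finset.sum_const, nsmul_eq_mul, mul_comm]
      rw [Finset.sum_congr rfl fun U _ => h₁ U, Finset.sum_comm, Finset.card_filter, Nat.cast_sum]
      refine Finset.sum_congr rfl fun g hg => ?_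
      have h₂ : A.powerset.filter (fun U => U ⊆ P g) = (P g).powerset := by
        ext U
        simp only [Finset.mem_filter, Finset.mem_powerset]
        exact ⟨fun h => h.2, fun h => ⟨h.trans (hPA g hg), h⟩⟩
      rw [← Finset.sum_filter, h₂, Finset.sum_powerset_neg_one_pow_card]
      push_cast
      rfl
    · intro U _ hn
      rw [mul_eq_zero, Nat.cast_eq_zero, Finset.card_eq_zero, Finset.filter_eq_empty_iff]
      refine Or.inr fun g hg h => ?_
      have h₁ := hPn g hg
      have h₂ := Finset.card_le_card h
      omega

end counting

open Classical in
theorem ncard_isRowChain_expansions (n L : ℕ) (hn : 1 ≤ n) :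
    ({g | IsRowChain n L g}.ncard : ℤ) = ∑ t ∈ Finset.range n, (L.choose t : ℤ) *
      ({g | IsRowChain (n - t) (L - t) g ∧ plusLabels (n - t) g = ∅}.ncard : ℕ) ∧
    ({g | IsRowChain n L g ∧ plusLabels n g = ∅}.ncard : ℤ) =
      ∑ t ∈ Finset.range n, (L.choose t : ℤ) *
        ((-1) ^ t * ({g | IsRowChain (n - t) (L - t) g}.ncard : ℕ)) := by
  set S := (finite_isRowChain n L).toFinset with hS
  have hmem : ∀ g, g ∈ S ↔ IsRowChain n L g := fun g => by simp [hS]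
  let P : (ℕ → ℕ → ℕ) → Finset ℕ := fun g => (Finset.Icc 1 L).filter (· ∈ plusLabels n g)
  have hP : ∀ g ∈ S, ((P g : Finset ℕ) : Set ℕ) = plusLabels n g := by
    intro g hg
    ext j
    simp only [P, Finset.coe_filter, Finset.mem_Icc]
    exact ⟨fun h => h.2, fun h => ⟨((hmem g).1 hg).bounds_of_mem_plusLabels h, h⟩⟩
  have hfilter : ∀ (p q : (ℕ → ℕ → ℕ) → Prop) [DecidablePred p], (∀ g ∈ S, (p g ↔ q g)) →
      (S.filter p).card = {g | IsRowChain n L g ∧ q g}.ncard := by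
    intro p q _ hpq
    rw [← Set.ncard_coe_finset]
    congr 1
    ext g
    simp only [Finset.coe_filter]
    exact ⟨fun h => ⟨(hmem g).1 h.1, (hpq g h.1).1 h.2⟩,
      fun h => ⟨(hmem g).2 h.1, (hpq g ((hmem g).2 h.1)).2 h.2⟩⟩
  have heq : ∀ U : Finset ℕ, ∀ g ∈ S, (P g = U ↔ plusLabels n g = (U : Set ℕ)) := fun U g hg => by
    rw [← hP g hg, Finset.coe_inj]
  have hsub : ∀ U : Finset ℕ, ∀ g ∈ S, (U ⊆ P g ↔ (U : Set ℕ) ⊆ plusLabels n g) := fun U g hg => by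
    rw [← hP g hg, Finset.coe_subset]
  have hIcc : ∀ U ⊆ Finset.Icc 1 L, ∀ u ∈ U, 1 ≤ u ∧ u ≤ L :=
    fun U hU u hu => Finset.mem_Icc.1 (hU hu)
  have key := card_eq_sum_and_card_eq_alternating_sum S P (Finset.Icc 1 L) n
    (fun t => {g | IsRowChain (n - t) (L - t) g ∧ plusLabels (n - t) g = ∅}.ncard)
    (fun t => {g | IsRowChain (n - t) (L - t) g}.ncard)
    (fun g _ => Finset.filter_subset _ _)
    (fun g hg => by
      have := ((hmem g).1 hg).card_le_of_subset_plusLabels (hP g hg).le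
      omega)
    (fun U hU hcard => by
      rw [hfilter _ _ (heq U)]
      exact (ncard_plusLabels U n L hcard (hIcc U hU)).2)
    (fun U hU hcard => by
      rw [hfilter _ _ (hsub U)]
      exact (ncard_plusLabels U n L hcard (hIcc U hU)).1)
  rw [Nat.card_Icc, Nat.add_sub_cancel] at key
  refine ⟨?_, ?_⟩
  · rw [← key.1, hS, Set.ncard_eq_toFinset_card _ (finite_isRowChain n L)]
  · rw [← key.2, hfilter _ _ (heq ∅), Finset.coe_empty]

/-! ### Steps are strip removals -/

/-- Going up from row `d`, there is a top row `e` of the strip as in `IsStripRemoval`: the first one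
whose predecessor `x` satisfies `f d + d ≤ f x + x`, or row `0`. -/
theorem exists_strip_top (f : ℕ → ℕ) (d : ℕ) :
    ∃ e ≤ d, (∀ x, e ≤ x → x < d → f x + x < f d + d) ∧ ∀ x, x + 1 = e → f d + d ≤ f x + x := by
  classical
  have hex : ∃ e, e ≤ d ∧ ∀ x, e ≤ x → x < d → f x + x < f d + d :=
    ⟨d, le_rfl, fun x h₁ h₂ => absurd h₂ (by omega)⟩
  refine ⟨Nat.find hex, (Nat.find_spec hex).1, (Nat.find_spec hex).2, fun x hx => ?_⟩
  by_contra hlt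
  refine Nat.find_min hex (m := x) (by omega) ⟨by have := (Nat.find_spec hex).1; omega, ?_⟩
  intro y h₁ h₂
  rcases h₁.eq_or_lt with rfl | h₁
  · omega
  · exact (Nat.find_spec hex).2 y (by omega) h₂

/-- The prime path of row `d` ends on the east steps between the north steps of row `e` and of row
`e - 1`, where row `e` is the top row of the strip. -/
theorem primeHeight_eq (Y : YoungDiagram) {e d : ℕ} (hed : e ≤ d)
    (hbelow : ∀ x, e ≤ x → x < d → Y.rowLen x + x < Y.rowLen d + d)
    (hret : ∀ x, x + 1 = e → Y.rowLen d + d ≤ Y.rowLen x + x) : primeHeight Y d = d + 1 - e := by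
  have hmem : d + 1 - e ∈
      {h | 1 ≤ h ∧ h ≤ d + 1 ∧ OnPath Y (Y.rowLen d + h) (d + 1 - h)} := by
    refine ⟨by omega, by omega, ?_, ?_⟩
    · rw [show d + 1 - (d + 1 - e) = e by omega]
      rcases hed.eq_or_lt with rfl | hlt
      · omega
      · have := hbelow e le_rfl hlt
        omega
    · rw [show d + 1 - (d + 1 - e) = e by omega]
      rcases Nat.eq_zero_or_pos e with he | he
      · exact Or.inl he
      · have := hret (e - 1) (by omega)
        exact Or.inr (by omega)
  refine le_antisymm (Nat.sInf_le hmem) (le_csInf ⟨_, hmem⟩ ?_)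
  rintro h ⟨h₁, h₂, -, h₃⟩
  by_contra hlt
  have h₄ := h₃.resolve_left (by omega)
  have h₅ := hbelow (d + 1 - h - 1) (by omega) (by omega)
  omega

theorem step_iff {Y Y' : Tam n} :
    Step Y Y' ↔ ∃ e d, IsStripRemoval Y.diagram.rowLen Y'.diagram.rowLen e d := by
  have hcells : ∀ e d, e ≤ d → primeHeight Y.diagram d = d + 1 - e →
      ((Y'.diagram.cells : Set (ℕ × ℕ)) = (Y.diagram.cells : Set (ℕ × ℕ)) \ strip Y.diagram d ↔
        ∀ x y, y < Y'.diagram.rowLen x ↔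
          y < Y.diagram.rowLen x ∧ ¬ (e ≤ x ∧ x ≤ d ∧ Y.diagram.rowLen x ≤ y + 1)) := by
    intro e d hed hph
    simp only [Set.ext_iff, Prod.forall, Set.mem_sdiff, strip, Set.mem_ofPred_eq, Finset.mem_coe,
      YoungDiagram.mem_cells, YoungDiagram.mem_iff_lt_rowLen, hph]
    refine forall_congr' fun x => forall_congr' fun y => iff_congr Iff.rfl ?_
    omega
  constructor
  · rintro ⟨⟨d, y⟩, ⟨h₁, h₂, h₃⟩, h⟩
    simp only [YoungDiagram.mem_iff_lt_rowLen] at h₁ h₂ h₃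
    obtain ⟨e, hed, hbelow, hret⟩ := exists_strip_top Y.diagram.rowLen d
    rw [hcells e d hed (primeHeight_eq _ hed hbelow hret)] at h
    refine ⟨e, d, hed, by omega, hbelow, hret, fun x => ?_⟩
    have hpos : x ≤ d → 1 ≤ Y.diagram.rowLen x := fun hx => by
      have := Y.diagram.rowLen_anti x d hx
      omega
    have h₄ := h x (Y'.diagram.rowLen x)
    have h₅ := h x (Y'.diagram.rowLen x - 1)
    have h₆ := h x (Y.diagram.rowLen x - 1)
    split_ifs <;> omega
  · rintro ⟨e, d, h⟩
    have hc := h.corner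
    refine ⟨(d, Y.diagram.rowLen d - 1), ⟨?_, ?_, ?_⟩, ?_⟩
    · simp only [YoungDiagram.mem_iff_lt_rowLen]
      omega
    · simp only [YoungDiagram.mem_iff_lt_rowLen]
      omega
    · simp only [YoungDiagram.mem_iff_lt_rowLen]
      omega
    · rw [hcells e d h.le (primeHeight_eq _ h.le h.below h.ret)]
      intro x y
      have h₁ := h.rows x
      split_ifs at h₁ <;> omega

/-! ### Diagrams with given row lengths -/

namespace Tam

theorem ext_rowLen {Y Y' : Tam n} (h : ∀ x, Y.diagram.rowLen x = Y'.diagram.rowLen x) : Y = Y' := by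
  refine Tam.ext (SetLike.ext ?_)
  rintro ⟨x, y⟩
  rw [YoungDiagram.mem_iff_lt_rowLen, YoungDiagram.mem_iff_lt_rowLen, h]

theorem rowLen_le (Y : Tam n) (x : ℕ) : Y.diagram.rowLen x ≤ n - 1 - x := by
  by_contra hlt
  have := Y.contained (x, n - 1 - x) (YoungDiagram.mem_iff_lt_rowLen.2 (by omega))
  simp only at this
  omega

theorem rowLen_anti_of_le {Y Y' : Tam n} (h : Y ≤ Y') (x : ℕ) :
    Y'.diagram.rowLen x ≤ Y.diagram.rowLen x := by
  by_contra hlt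
  have h₁ : (x, Y.diagram.rowLen x) ∈ Y'.diagram := YoungDiagram.mem_iff_lt_rowLen.2 (by omega)
  have h₂ := YoungDiagram.mem_iff_lt_rowLen.1 (subset_of_reflTransGen h h₁)
  omega

theorem exists_rowLen_eq (f : ℕ → ℕ) (hf : Antitone f) (hfn : ∀ x, f x ≤ n - 1 - x) :
    ∃ Y : Tam n, ∀ x, Y.diagram.rowLen x = f x := by
  let D : YoungDiagram :=
    { cells := (Finset.range n ×ˢ Finset.range n).filter fun c => c.2 < f c.1
      isLowerSet := by
        rintro ⟨x, y⟩ ⟨x', y'⟩ ⟨h₁, h₂⟩ h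
        simp only [Finset.coe_filter, Finset.mem_product, Finset.mem_range] at h ⊢
        have h₃ : f x ≤ f x' := hf h₁
        simp only at h₁ h₂
        exact ⟨⟨lt_of_le_of_lt h₁ h.1.1, lt_of_le_of_lt h₂ h.1.2⟩,
          lt_of_le_of_lt h₂ (h.2.trans_le h₃)⟩ }
  have hD : ∀ x y, (x, y) ∈ D ↔ y < f x := by
    intro x y
    have h₁ : (x, y) ∈ D ↔ (x, y) ∈ (Finset.range n ×ˢ Finset.range n).filter
      fun c => c.2 < f c.1 := Iff.rfl
    rw [h₁]
    simp only [Finset.mem_filter, Finset.mem_product, Finset.mem_range]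
    refine ⟨fun h => h.2, fun h => ⟨?_, h⟩⟩
    have := hfn x
    omega
  refine ⟨⟨D, ?_⟩, fun x => ?_⟩
  · rintro ⟨x, y⟩ h
    have h₁ := (hD x y).1 h
    have h₂ := hfn x
    simp only
    omega
  · refine le_antisymm (le_of_not_gt fun h => ?_) (le_of_not_gt fun h => ?_)
    · exact lt_irrefl _ ((hD x (f x)).1 (YoungDiagram.mem_iff_lt_rowLen.2 h))
    · exact lt_irrefl _ (YoungDiagram.mem_iff_lt_rowLen.1 ((hD x _).2 h))

instance : Finite (Tam n) := by
  refine Finite.of_injective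
    (fun (Y : Tam n) (x : Fin n) => (⟨Y.diagram.rowLen x, by have := Y.rowLen_le x; omega⟩ :
      Fin (n + 1))) fun Y Y' h => ext_rowLen fun x => ?_
  rcases lt_or_ge x n with hx | hx
  · exact congr_arg Fin.val (congr_fun h ⟨x, hx⟩)
  · have h₁ := Y.rowLen_le x
    have h₂ := Y'.rowLen_le x
    omega

end Tam

/-! ### Steps are the covering relations -/

theorem Step.lt {Y Y' : Tam n} (h : Step Y Y') : Y < Y' := by
  refine lt_of_le_of_ne (Relation.ReflTransGen.single h) ?_
  rintro rfl
  obtain ⟨e, d, hm⟩ := step_iff.1 h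
  have := hm.rows_mem hm.le le_rfl
  omega

/-- If two diagrams are related by a strip removal, then no other strip removal from the first one
stays below the second one: the removed strip would be a proper part of the given strip, so that
a later strip removal has to remove the last box of row `d`, and with it a second box of a row of the
smaller strip. -/
theorem Step.eq_of_le {Y Y' Z : Tam n} (h : Step Y Y') (hZ : Step Y Z) (hle : Z ≤ Y') : Z = Y' := by
  obtain ⟨e, d, hm⟩ := step_iff.1 h
  obtain ⟨a, b, hab⟩ := step_iff.1 hZ
  have hle' := hab.le
  have hb₁ := hab.rows_mem hle' le_rfl
  have hmemb : e ≤ b ∧ b ≤ d := by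
    by_contra hb
    have h₂ := hm.rows_notMem hb
    have h₃ := Tam.rowLen_anti_of_le hle b
    omega
  rcases hmemb.2.eq_or_lt with rfl | hbd
  · obtain rfl := hm.top_unique hab
    refine Tam.ext_rowLen fun x => ?_
    have h₁ := hm.rows x
    have h₂ := hab.rows x
    omega
  exfalso
  have hb₂ := hm.rows_mem hmemb.1 hmemb.2
  have hd := hm.rows_mem hm.le le_rfl
  have key : ∀ W : Tam n, W ≤ Y' → (∀ x, W.diagram.rowLen x ≤ Y.diagram.rowLen x) →
      W.diagram.rowLen d = Y.diagram.rowLen d →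
      W.diagram.rowLen b + 1 ≤ Y.diagram.rowLen b → False := by
    intro W hW
    induction hW using Relation.ReflTransGen.head_induction_on with
    | refl =>
      intro _ h₂ _
      omega
    | @head W V hWV hVY ih =>
      intro h₁ h₂ h₃
      obtain ⟨p, q, hpq⟩ := step_iff.1 hWV
      have hV : ∀ x, V.diagram.rowLen x ≤ Y.diagram.rowLen x :=
        fun x => (hpq.anti_le x).trans (h₁ x)
      have h₄ := hpq.anti_le b
      by_cases hd' : p ≤ d ∧ d ≤ q
      · have hq : q = d := by
          by_contra hne
          have h₅ := hpq.rows_mem hpq.le le_rfl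
          have h₆ := Tam.rowLen_anti_of_le hVY q
          have h₇ := hm.rows_notMem (x := q) (by omega)
          have h₈ := h₁ q
          omega
        subst hq
        have hpb : p ≤ b := by
          by_contra hpb
          have h₅ := hpq.ret (p - 1) (by omega)
          have h₆ := hm.below (p - 1) (by omega) (by omega)
          have h₇ := h₁ (p - 1)
          omega
        have h₅ := hpq.rows_mem hpb hbd.le
        have h₆ := Tam.rowLen_anti_of_le hVY b
        omega
      · exact ih hV ((hpq.rows_notMem hd').symm.trans h₂) (by omega)
  exact key Z hle hab.anti_le (hab.rows_notMem (by omega)).symm (by omega)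

theorem covBy_iff_step {Y Y' : Tam n} : Y ⋖ Y' ↔ Step Y Y' := by
  constructor
  · intro h
    rcases Relation.ReflTransGen.cases_head h.le with heq | ⟨Z, h₁, h₂⟩
    · exact absurd heq h.lt.ne
    · rcases eq_or_lt_of_le (show Z ≤ Y' from h₂) with rfl | hlt
      · exact h₁
      · exact absurd hlt (h.2 h₁.lt)
  · intro h
    refine ⟨h.lt, fun Z h₁ h₂ => ?_⟩
    rcases Relation.ReflTransGen.cases_head h₁.le with heq | ⟨W, h₃, h₄⟩
    · exact h₁.ne heq
    · have h₅ : W ≤ Z := h₄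
      obtain rfl := h.eq_of_le h₃ (h₅.trans h₂.le)
      exact h₂.not_ge h₅

/-- Unless all rows are empty, there is a corner box to start a strip removal. -/
theorem exists_step_of_rowLen_ne {Y : Tam n} (h : ∃ x, Y.diagram.rowLen x ≠ 0) :
    ∃ Y', Step Y Y' := by
  have hd : ∃ d, Y.diagram.rowLen (d + 1) < Y.diagram.rowLen d := by
    by_contra! hd
    obtain ⟨x, hx⟩ := h
    have h₁ := monotone_nat_of_le_succ hd (Nat.le_add_right x n)
    have h₂ := Y.rowLen_le (x + n)
    omega
  obtain ⟨d, hd⟩ := hd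
  obtain ⟨e, hed, hbelow, hret⟩ := exists_strip_top Y.diagram.rowLen d
  have hm : IsStripRemoval Y.diagram.rowLen
      (fun x => Y.diagram.rowLen x - if e ≤ x ∧ x ≤ d then 1 else 0) e d := by
    refine ⟨hed, hd, hbelow, hret, fun x => ?_⟩
    have h₁ := Y.diagram.rowLen_anti x d
    split_ifs <;> omega
  obtain ⟨Y', hY'⟩ := Tam.exists_rowLen_eq (n := n) _
    (hm.antitone_right fun x y hxy => Y.diagram.rowLen_anti x y hxy)
    fun x => (hm.anti_le x).trans (Y.rowLen_le x)
  exact ⟨Y', step_iff.2 ⟨e, d, by rwa [funext hY']⟩⟩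

/-- Unless all rows are full, a box can be added to the first row that is not. This box is a strip
by itself, since the preceding row is full. -/
theorem exists_step_to_of_rowLen_ne {Y : Tam n} (h : ∃ x, Y.diagram.rowLen x ≠ n - 1 - x) :
    ∃ Y', Step Y' Y := by
  classical
  obtain ⟨d, hd, hlt⟩ : ∃ d, Y.diagram.rowLen d ≠ n - 1 - d ∧
      ∀ x < d, Y.diagram.rowLen x = n - 1 - x :=
    ⟨Nat.find h, Nat.find_spec h, fun x hx => not_not.1 (Nat.find_min h hx)⟩
  have hle := Y.rowLen_le d
  have hanti := Y.diagram.rowLen_anti d (d + 1) (by omega)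
  have hm : IsStripRemoval (fun x => Y.diagram.rowLen x + if d ≤ x ∧ x ≤ d then 1 else 0)
      Y.diagram.rowLen d d := by
    refine ⟨le_rfl, ?_, fun x h₁ h₂ => absurd h₁ (by omega), fun x hx => ?_, fun x => rfl⟩
    · rw [if_neg (by omega), if_pos (by omega)]
      omega
    · rw [if_pos (by omega), if_neg (by omega), hlt x (by omega)]
      omega
  obtain ⟨Y', hY'⟩ := Tam.exists_rowLen_eq (n := n) _
    (hm.antitone_left fun x y hxy => Y.diagram.rowLen_anti x y hxy)
    fun x => by
      have := Y.rowLen_le x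
      split_ifs with hx
      · obtain rfl : x = d := by omega
        omega
      · exact this
  exact ⟨Y', step_iff.2 ⟨d, d, by rwa [funext hY']⟩⟩

/-- The empty diagram is the maximum. -/
theorem le_of_rowLen_eq_zero {T : Tam n} (hT : ∀ x, T.diagram.rowLen x = 0) (Y : Tam n) :
    Y ≤ T := by
  induction Y using WellFoundedGT.induction with
  | ind Y ih =>
    by_cases h : ∃ x, Y.diagram.rowLen x ≠ 0
    · obtain ⟨Y', hY'⟩ := exists_step_of_rowLen_ne h
      exact hY'.lt.le.trans (ih Y' hY'.lt)
    · push Not at h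
      exact (Tam.ext_rowLen fun x => (h x).trans (hT x).symm).le

/-- The staircase is the minimum. -/
theorem le_of_rowLen_eq_last {B : Tam n} (hB : ∀ x, B.diagram.rowLen x = n - 1 - x) (Y : Tam n) :
    B ≤ Y := by
  induction Y using WellFoundedLT.induction with
  | ind Y ih =>
    by_cases h : ∃ x, Y.diagram.rowLen x ≠ n - 1 - x
    · obtain ⟨Y', hY'⟩ := exists_step_to_of_rowLen_ne h
      exact (ih Y' hY'.lt).trans hY'.lt.le
    · push Not at h
      exact (Tam.ext_rowLen fun x => (h x).trans (hB x).symm).ge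

/-! ### Maximal chains and their tableaux -/

namespace MaximalChain

/-- A decreasing sequence is a maximal chain if and only if it goes from the maximum to the minimum
by covering relations. -/
theorem isMaxChain_iff {L : ℕ} {Y : Fin (L + 1) → Tam n} (hY : StrictAnti Y) :
    IsMaxChain (· ≤ ·) (Set.range Y) ↔ (∀ x, (Y 0).diagram.rowLen x = 0) ∧
      (∀ x, (Y (Fin.last L)).diagram.rowLen x = n - 1 - x) ∧
      ∀ k : Fin L, Step (Y k.succ) (Y k.castSucc) := by
  obtain ⟨T, hT⟩ := Tam.exists_rowLen_eq (n := n) (fun _ => 0) (fun _ _ _ => le_rfl)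
    fun _ => Nat.zero_le _
  obtain ⟨B, hB⟩ := Tam.exists_rowLen_eq (n := n) (fun x => n - 1 - x)
    (fun x y hxy => by simp only; omega) fun _ => le_rfl
  let : BoundedOrder (Tam n) :=
    { top := T
      le_top := le_of_rowLen_eq_zero hT
      bot := B
      bot_le := le_of_rowLen_eq_last hB }
  have htop : Y 0 = ⊤ ↔ ∀ x, (Y 0).diagram.rowLen x = 0 :=
    ⟨fun h => h ▸ hT, fun h => Tam.ext_rowLen fun x => (h x).trans (hT x).symm⟩
  have hbot : Y (Fin.last L) = ⊥ ↔ ∀ x, (Y (Fin.last L)).diagram.rowLen x = n - 1 - x :=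
    ⟨fun h => h ▸ hB, fun h => Tam.ext_rowLen fun x => (h x).trans (hB x).symm⟩
  rw [← htop, ← hbot]
  constructor
  · intro h
    refine ⟨?_, ?_, fun k => covBy_iff_step.1 ⟨hY k.castSucc_lt_succ, fun Z h₁ h₂ => ?_⟩⟩
    · obtain ⟨k, hk⟩ := h.top_mem
      exact top_le_iff.1 (hk ▸ hY.antitone (Fin.zero_le k))
    · obtain ⟨k, hk⟩ := h.bot_mem
      exact le_bot_iff.1 (hk ▸ hY.antitone (Fin.le_last k))
    · have hch : IsChain (· ≤ ·) (insert Z (Set.range Y)) := by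
        refine h.isChain.insert ?_
        rintro _ ⟨j, rfl⟩ _
        rcases le_or_gt j k.castSucc with hj | hj
        · exact Or.inl (h₂.le.trans (hY.antitone hj))
        · exact Or.inr ((hY.antitone (Fin.castSucc_lt_iff_succ_le.1 hj)).trans h₁.le)
      obtain ⟨j, rfl⟩ : Z ∈ Set.range Y := by
        rw [h.2 hch (Set.subset_insert _ _)]
        exact Set.mem_insert _ _
      have h₃ := hY.lt_iff_gt.1 h₁
      have h₄ := hY.lt_iff_gt.1 h₂
      exact h₄.not_ge (Fin.le_castSucc_iff.2 h₃)
  · rintro ⟨h₁, h₂, h₃⟩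
    have h := IsMaxChain.range_fin_of_covBy (α := (Tam n)ᵒᵈ) (f := fun k => OrderDual.toDual (Y k))
      (congr_arg OrderDual.toDual h₁) (congr_arg OrderDual.toDual h₂)
      fun k => (covBy_iff_step.2 (h₃ k)).toDual.wcovBy
    exact h.symm

/-- The row lengths of the diagrams of a chain, constant from the end of the chain on. -/
noncomputable def rows (C : MaximalChain n) : ℕ → ℕ → ℕ := fun s x =>
  (C.Y ⟨min s C.length, by omega⟩).diagram.rowLen x

theorem rows_val (C : MaximalChain n) (k : Fin (C.length + 1)) (x : ℕ) :
    C.rows k x = (C.Y k).diagram.rowLen x := by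
  have : (⟨min (k : ℕ) C.length, by omega⟩ : Fin (C.length + 1)) = k :=
    Fin.ext (min_eq_left (by omega))
  rw [rows, this]

theorem rows_of_le (C : MaximalChain n) {s : ℕ} (hs : C.length ≤ s) :
    C.rows s = C.rows C.length := by
  funext x
  simp only [rows, min_eq_right hs, min_self]

theorem isRowChain_rows (C : MaximalChain n) : IsRowChain n C.length C.rows := by
  obtain ⟨h₁, h₂, h₃⟩ := (isMaxChain_iff C.strictAnti).1 C.isMaxChain
  refine ⟨fun x => ?_, fun s hs => ?_, fun s hs x => ?_⟩
  · exact (C.rows_val 0 x).trans (h₁ x)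
  · obtain ⟨e, d, h⟩ := step_iff.1 (h₃ ⟨s, hs⟩)
    refine ⟨e, d, ?_⟩
    rw [← funext (C.rows_val _), ← funext (C.rows_val _)] at h
    exact h
  · rw [C.rows_of_le hs, ← h₂ x]
    exact C.rows_val (Fin.last _) x

theorem rows_injOn (L : ℕ) :
    Set.InjOn (rows : MaximalChain n → ℕ → ℕ → ℕ) {C | C.length = L} := by
  rintro ⟨L, Y, h₁, h₂⟩ rfl ⟨L', Y', h₁', h₂'⟩ hL heq
  obtain rfl : L' = L := hL
  obtain rfl : Y = Y' := by
    funext k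
    refine Tam.ext_rowLen fun x => ?_
    have := congr_fun (congr_fun heq k) x
    rwa [rows_val ⟨L', Y, h₁, h₂⟩ k x, rows_val ⟨L', Y', h₁', h₂'⟩ k x] at this
  rfl

theorem exists_rows_eq {L : ℕ} {g : ℕ → ℕ → ℕ} (hg : IsRowChain n L g) :
    ∃ C : MaximalChain n, C.length = L ∧ C.rows = g := by
  choose Y hY using fun s => Tam.exists_rowLen_eq (n := n) (g s) (hg.antitone s) (hg.le_last s)
  have hstep : ∀ k : Fin L, Step (Y k.succ) (Y k.castSucc) := fun k => by
    obtain ⟨e, d, h⟩ := hg.step k k.2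
    refine step_iff.2 ⟨e, d, ?_⟩
    rw [funext (hY _), funext (hY _)]
    exact h
  have hanti : StrictAnti fun k : Fin (L + 1) => Y k :=
    Fin.strictAnti_iff_succ_lt.2 fun k => (hstep k).lt
  refine ⟨⟨L, fun k => Y k, hanti, (isMaxChain_iff hanti).2 ⟨fun x => ?_, fun x => ?_, hstep⟩⟩,
    rfl, ?_⟩
  · exact (hY 0 x).trans (hg.zero x)
  · exact (hY _ x).trans (hg.last _ le_rfl x)
  · funext s x
    refine (hY _ x).trans ?_
    rcases le_total s L with hs | hs
    · exact congr_fun (congr_arg g (min_eq_left hs)) x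
    · rw [hg.last _ hs, hg.last _ (le_min hs le_rfl)]

theorem mem_rSet (C : MaximalChain n) {r x y : ℕ} :
    (x, y) ∈ C.rSet r ↔ 1 ≤ r ∧ C.rows (r - 1) x ≤ y ∧ y < C.rows r x := by
  constructor
  · rintro ⟨k, rfl, h₁, h₂⟩
    rw [YoungDiagram.mem_iff_lt_rowLen, ← C.rows_val] at h₁ h₂
    exact ⟨by omega, not_lt.1 h₂, h₁⟩
  · rintro ⟨h₁, h₂, h₃⟩
    obtain ⟨s, rfl⟩ : ∃ s, r = s + 1 := ⟨r - 1, by omega⟩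
    have hs : s < C.length := by
      by_contra hs
      rw [Nat.add_sub_cancel, C.rows_of_le (not_lt.1 hs)] at h₂
      rw [C.rows_of_le (by omega)] at h₃
      omega
    refine ⟨⟨s, hs⟩, rfl, ?_, ?_⟩
    · rw [YoungDiagram.mem_iff_lt_rowLen, ← C.rows_val]
      exact h₃
    · rw [YoungDiagram.mem_iff_lt_rowLen, ← C.rows_val]
      exact not_lt.2 h₂

/-- A box has a label less than `r` if and only if it is in the diagram at time `r - 1`. For
`r = 0` both sides are false, since the diagram at time `0` is empty. -/
theorem exists_lt_mem_rSet (C : MaximalChain n) {r x y : ℕ} :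
    (∃ s < r, (x, y) ∈ C.rSet s) ↔ y < C.rows (r - 1) x := by
  constructor
  · rintro ⟨s, hs, h⟩
    exact (C.mem_rSet.1 h).2.2.trans_le (C.isRowChain_rows.mono (by omega) x)
  · intro h
    have key : ∀ t, y < C.rows t x → ∃ s ≤ t, (x, y) ∈ C.rSet s := by
      intro t
      induction t with
      | zero => exact fun h => absurd h (by rw [C.isRowChain_rows.zero]; omega)
      | succ t ih =>
        intro h
        rcases lt_or_ge y (C.rows t x) with h' | h'
        · obtain ⟨s, hs, hs'⟩ := ih h'
          exact ⟨s, by omega, hs'⟩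
        · exact ⟨t + 1, le_rfl, C.mem_rSet.2 ⟨by omega, h', h⟩⟩
    obtain ⟨s, hs, hs'⟩ := key _ h
    refine ⟨s, ?_, hs'⟩
    have := (C.mem_rSet.1 hs').1
    omega

theorem plusFullSetLabels_eq (C : MaximalChain n) :
    C.plusFullSetLabels = plusLabels n C.rows := by
  have hC := C.isRowChain_rows
  ext j
  constructor
  · rintro ⟨⟨k, y⟩, ⟨⟨⟨z, y₀⟩, hc, hz⟩, ⟨hk, hmax⟩, hn⟩, h⟩
    simp only at hz hn h hmax
    subst hz
    rw [C.exists_lt_mem_rSet] at h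
    rw [C.mem_rSet] at hc hk
    obtain ⟨s, rfl⟩ : ∃ s, j = s + 1 := ⟨j - 1, by omega⟩
    rw [Nat.add_sub_cancel] at hc hk h
    have hs : s < C.length := by
      by_contra hs
      rw [C.rows_of_le (not_lt.1 hs), C.rows_of_le (s := s + 1) (by omega)] at hc
      omega
    obtain ⟨e, d, hm⟩ := hC.step s hs
    have hmem : ∀ x, C.rows s x < C.rows (s + 1) x → e ≤ x ∧ x ≤ d := fun x hx => by
      by_contra hx'
      have := hm.rows_notMem hx'
      omega
    have hek := hmem k (by omega)
    have he0 := hmem 0 (by omega)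
    have hdk : d ≤ k := by
      have := hm.rows_mem hm.le le_rfl
      exact hmax (d, C.rows s d) (C.mem_rSet.2 ⟨by omega, by rw [Nat.add_sub_cancel], by omega⟩)
    obtain rfl : d = k := by omega
    have h₁ := hm.rows_mem hek.1 hek.2
    have h₂ := hC.le_last s (d + 1)
    refine ⟨d, by omega, fun x hx => ?_, by omega, ?_, ?_⟩
    · have := hm.below x (by omega) hx
      omega
    · rw [Nat.add_sub_cancel]
      omega
    · rw [Nat.add_sub_cancel]
      omega
  · intro hj
    have hj' := hC.bounds_of_mem_plusLabels hj
    obtain ⟨k, h₁, h₂, h₃, h₄, h₅⟩ := hj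
    obtain ⟨s, rfl⟩ : ∃ s, j = s + 1 := ⟨j - 1, by omega⟩
    rw [Nat.add_sub_cancel] at h₄ h₅
    obtain ⟨e, d, hm⟩ := hC.step s (by omega)
    obtain ⟨rfl, rfl⟩ := hC.strip_of_full hm h₂ h₃ h₄
    have hbox : ∀ x ≤ d, (x, C.rows s x) ∈ C.rSet (s + 1) := fun x hx => by
      have := hm.rows_mem (Nat.zero_le x) hx
      exact C.mem_rSet.2 ⟨by omega, by rw [Nat.add_sub_cancel], by omega⟩
    have hd := hm.rows_mem (Nat.zero_le d) le_rfl
    refine ⟨(d, C.rows s d), ⟨⟨_, hbox 0 (Nat.zero_le d), rfl⟩, ⟨hbox d le_rfl, ?_⟩, ?_⟩, ?_⟩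
    · rintro ⟨x, y⟩ hxy
      by_contra hx
      have h₆ := hm.rows_notMem (x := x) (by simp only at hx; omega)
      have h₇ := C.mem_rSet.1 hxy
      rw [Nat.add_sub_cancel] at h₇
      omega
    · simp only
      omega
    · rw [C.exists_lt_mem_rSet, Nat.add_sub_cancel]
      simp only
      omega

end MaximalChain

/-! ### Counting chains by counting row chains -/

section transfer

variable {i : ℤ}

theorem rows_image (hL : (L : ℤ) = n + i) (p : Set ℕ → Prop) :
    MaximalChain.rows '' {C ∈ chains i n | p C.plusFullSetLabels} =
      {g | IsRowChain n L g ∧ p (plusLabels n g)} := by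
  ext g
  constructor
  · rintro ⟨C, ⟨h₁, h₂⟩, rfl⟩
    have h₃ : (C.length : ℤ) = n + i := h₁
    obtain rfl : C.length = L := by omega
    exact ⟨C.isRowChain_rows, C.plusFullSetLabels_eq ▸ h₂⟩
  · rintro ⟨h₁, h₂⟩
    obtain ⟨C, rfl, rfl⟩ := MaximalChain.exists_rows_eq h₁
    exact ⟨C, ⟨hL, C.plusFullSetLabels_eq ▸ h₂⟩, rfl⟩

theorem rows_injOn_chains (hL : (L : ℤ) = n + i) :
    Set.InjOn (MaximalChain.rows : MaximalChain n → ℕ → ℕ → ℕ) (chains i n) :=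
  (MaximalChain.rows_injOn L).mono fun C (hC : (C.length : ℤ) = n + i) =>
    show C.length = L by omega

theorem ncard_chains_filter (hL : (L : ℤ) = n + i) (p : Set ℕ → Prop) :
    {C ∈ chains i n | p C.plusFullSetLabels}.ncard =
      {g | IsRowChain n L g ∧ p (plusLabels n g)}.ncard := by
  rw [← rows_image hL]
  exact (((rows_injOn_chains hL).mono fun C hC => hC.1).ncard_image).symm

theorem ncard_chains (hL : (L : ℤ) = n + i) :
    (chains i n).ncard = {g | IsRowChain n L g}.ncard := by
  simpa using ncard_chains_filter hL fun _ => True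

theorem ncard_noFull (hL : (L : ℤ) = n + i) :
    (noFull i n).ncard = {g | IsRowChain n L g ∧ plusLabels n g = ∅}.ncard := by
  rw [← ncard_chains_filter hL fun S => S = ∅]
  congr 1
  ext C
  exact and_congr_right fun _ => Set.eq_empty_iff_forall_notMem.symm

theorem finite_chains (hL : (L : ℤ) = n + i) : (chains i n).Finite := by
  refine Set.Finite.of_finite_image ((finite_isRowChain n L).subset ?_) (rows_injOn_chains hL)
  rintro _ ⟨C, hC, rfl⟩
  have hC' : (C.length : ℤ) = n + i := hC
  obtain rfl : C.length = L := by omega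
  exact C.isRowChain_rows

end transfer

/-- The substitution `t ↦ n - t` in a sum with binomial coefficients `L.choose t`. -/
theorem sum_range_choose_eq_sum_Icc {M : Type*} [AddCommMonoid M] {L n : ℕ} {i : ℤ}
    (hi : -1 ≤ i) (hL : (L : ℤ) = n + i) (F : ℕ → ℕ → ℕ → M) :
    ∑ t ∈ Finset.range n, F t (L.choose t) (n - t) =
      ∑ t ∈ Finset.Icc 1 n, F (n - t) (L.choose (t + i).toNat) t := by
  refine Finset.sum_bij' (fun t _ => n - t) (fun t _ => n - t) ?_ ?_ ?_ ?_ ?_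
  · intro t ht
    rw [Finset.mem_range] at ht
    rw [Finset.mem_Icc]
    omega
  · intro t ht
    rw [Finset.mem_Icc] at ht
    rw [Finset.mem_range]
    omega
  · intro t ht
    rw [Finset.mem_range] at ht
    omega
  · intro t ht
    rw [Finset.mem_Icc] at ht
    omega
  · intro t ht
    rw [Finset.mem_range] at ht
    have h₁ : (((n - t : ℕ) : ℤ) + i).toNat = L - t := by omega
    rw [h₁, Nat.choose_symm (by omega), Nat.sub_sub_self ht.le]

end Tamari

theorem corollary5p6 (i : ℤ) (hi : -1 ≤ i) (n : ℕ) (hn : 1 ≤ n) :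
    (Tamari.chains i n).Finite ∧
    (∀ (U : Finset ℕ) (t : ℕ), (∀ u ∈ U, 1 ≤ u ∧ (u : ℤ) ≤ n + i) → U.card = t → t ≤ n - 1 →
      {C ∈ Tamari.chains i n | C.plusFullSetLabels = (U : Set ℕ)}.ncard =
          (Tamari.noFull i (n - t)).ncard ∧
      {C ∈ Tamari.chains i n | (U : Set ℕ) ⊆ C.plusFullSetLabels}.ncard =
          (Tamari.chains i (n - t)).ncard) ∧
    (Tamari.chains i n).ncard =
      ∑ t ∈ Finset.range n, (n + i).toNat.choose t * (Tamari.noFull i (n - t)).ncard ∧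
    (Tamari.chains i n).ncard =
      ∑ t ∈ Finset.Icc 1 n, (n + i).toNat.choose (t + i).toNat * (Tamari.noFull i t).ncard ∧
    ((Tamari.noFull i n).ncard : ℤ) =
      ∑ t ∈ Finset.range n,
        (-1) ^ t * ((n + i).toNat.choose t : ℤ) * ((Tamari.chains i (n - t)).ncard : ℤ) ∧
    ((Tamari.noFull i n).ncard : ℤ) =
      ∑ t ∈ Finset.Icc 1 n,
        (-1) ^ (n - t) * ((n + i).toNat.choose (t + i).toNat : ℤ) *
          ((Tamari.chains i t).ncard : ℤ) := by
  obtain ⟨L, hL⟩ : ∃ L : ℕ, (L : ℤ) = n + i := ⟨(n + i).toNat, by omega⟩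
  have hLt : ∀ t ≤ n - 1, ((L - t : ℕ) : ℤ) = (n - t : ℕ) + i := fun t ht => by omega
  rw [← hL, Int.toNat_natCast]
  obtain ⟨h₁, h₂⟩ := Tamari.ncard_isRowChain_expansions n L hn
  have h₃ : (Tamari.chains i n).ncard =
      ∑ t ∈ Finset.range n, L.choose t * (Tamari.noFull i (n - t)).ncard := by
    rw [Tamari.ncard_chains hL]
    zify
    rw [h₁]
    refine Finset.sum_congr rfl fun t ht => ?_
    rw [Finset.mem_range] at ht
    rw [Tamari.ncard_noFull (hLt t (by omega))]
  have h₄ : ((Tamari.noFull i n).ncard : ℤ) =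
      ∑ t ∈ Finset.range n,
        (-1) ^ t * (L.choose t : ℤ) * ((Tamari.chains i (n - t)).ncard : ℤ) := by
    rw [Tamari.ncard_noFull hL, h₂]
    refine Finset.sum_congr rfl fun t ht => ?_
    rw [Finset.mem_range] at ht
    rw [Tamari.ncard_chains (hLt t (by omega)), mul_left_comm, mul_assoc]
  refine ⟨Tamari.finite_chains hL, ?_, h₃, ?_, h₄, ?_⟩
  · rintro U t hU rfl ht
    obtain ⟨h₅, h₆⟩ := Tamari.ncard_plusLabels U n L (by omega) fun u hu =>
      ⟨(hU u hu).1, by have := (hU u hu).2; omega⟩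
    rw [Tamari.ncard_noFull (hLt _ ht), Tamari.ncard_chains (hLt _ ht), ← h₅, ← h₆]
    exact ⟨Tamari.ncard_chains_filter hL fun S => S = (U : Set ℕ),
      Tamari.ncard_chains_filter hL fun S => (U : Set ℕ) ⊆ S⟩
  · rw [h₃]
    exact Tamari.sum_range_choose_eq_sum_Icc hi hL fun _ c m => c * (Tamari.noFull i m).ncard
  · rw [h₄]
    exact Tamari.sum_range_choose_eq_sum_Icc hi hL
      fun t c m => (-1 : ℤ) ^ t * (c : ℤ) * ((Tamari.chains i m).ncard : ℤ)
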